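/- Let $m \geq 1$ be an integer. All functions are real-valued. Let $\dot H^{1/2}(\mathbb{R})$ be the space of all $f$ with $\int_{\mathbb{R}} \frac{|f(x)|}{1+x^2}\,dx < \infty$ and $$\|f\|_{\dot H^{1/2}}^2 = \frac{1}{2\pi} \iint_{\mathbb{R}\times\mathbb{R}} \frac{|f(x)-f(y)|^2}{|x-y|^2}\,dx\,dy < \infty ,$$ and write $(f, |\nabla| g) = \frac{1}{2\pi}\iint \frac{(f(x)-f(y))(g(x)-g(y))}{|x-y|^2}\,dx\,dy$, so that $(f,|\nabla| f) = \|f\|_{\dot H^{1/2}}^2$. Let $Q_m(x) = \left(\mathrm{i}\,\frac{x-\mathrm{i}}{x+\mathrm{i}}\right)^m$ and consider $$L_+ = |\nabla| - \frac{2m}{1+x^2}, \qquad L_- = L_+ + R, \qquad (Rf)(x) = \frac{1}{2\pi} \int_{\mathbb{R}} \frac{|Q_m(x)-Q_m(y)|^2}{|x-y|^2} f(y)\,dy .$$ As an operator on $L^2(\mathbb{R})$ with domain $H^1(\mathbb{R})$, $L_+$ has (up to scalar factors) exactly $2m$ eigenfunctions $\varphi_0, \ldots, \varphi_{2m-1}$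 with eigenvalues at most $0$; they are simple, with eigenvalues $E_0 < E_1 < \cdots < E_{2m-2} < E_{2m-1} = 0$. Moreover, $L_+$ has a zero energy resonance, i.e. a function $\varphi \in \dot H^{1/2}(\mathbb{R}) \setminus L^2(\mathbb{R})$ with $L_+\varphi = 0$. For any choice of such $\varphi_0,\dots,\varphi_{2m-1}$ and $\varphi$, set $$\psi_k = \varphi_k \ \ (0 \leq k \leq 2m-2), \qquad \psi_{2m-1} = \frac{\varphi_{2m-1}}{1+x^2}, \qquad \psi_{2m} = \frac{\varphi}{1+x^2} .$$ Then for $f \in \dot H^{1/2}(\mathbb{R})$ the integrals $\int \psi_k f\,dx$ and those defining $(f, L_\pm f)$ converge absolutely, and if $f, g \in \dot H^{1/2}(\mathbb{R})$ satisfy $$\int_{\mathbb{R}} \psi_k f\,dx = \int_{\mathbb{R}} \psi_k g\,dx = 0 \qquad \text{for } 0 \leq k \leq 2m ,$$ then $$(f, L_+ f) + (g, L_- g) \geq \frac{1}{m+1}\left( \|f\|_{\dot H^{1/2}}^2 + \|g\|_{\dot H^{1/2}}^2 \right).$$ The constant $\frac{1}{m+1}$ is optimal: no larger constant $c$ in its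 place makes the estimate true for all such $f, g$. -/

import Mathlib

open MeasureTheory

namespace HalfWave

noncomputable section

/-- The energy space `Ḣ^{1/2}(ℝ)`: real functions with `∫ |f(x)| / (1 + x²) dx < ∞` and finite
Gagliardo energy `∬ |f(x) - f(y)|² / |x - y|² dx dy < ∞`. -/
def MemHdotHalf (f : ℝ → ℝ) : Prop :=
  Integrable (fun x : ℝ => f x / (1 + x ^ 2)) ∧
    Integrable (fun p : ℝ × ℝ => (f p.1 - f p.2) ^ 2 / (p.1 - p.2) ^ 2)

/-- The bilinear form `(f, |∇| g) = (2π)⁻¹ ∬ (f(x) - f(y)) (g(x) - g(y)) / |x - y|² dx dy`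
of the half-Laplacian `|∇|` on `Ḣ^{1/2}(ℝ)`. -/
def halfLapForm (f g : ℝ → ℝ) : ℝ :=
  (1 / (2 * Real.pi)) *
    ∫ p : ℝ × ℝ, (f p.1 - f p.2) * (g p.1 - g p.2) / (p.1 - p.2) ^ 2

/-- The squared (semi)norm `‖f‖² = (f, |∇| f)` of `Ḣ^{1/2}(ℝ)`. -/
def hdotNormSq (f : ℝ → ℝ) : ℝ := halfLapForm f f

/-- The half-harmonic map `Q_m = f_m + i g_m`, `Q_m(x) = (i (x - i) / (x + i))^m`. The target
circle is the equator of the sphere, `(f_m, g_m, 0)`, so distances are those of `ℂ`. -/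
def Qmap (m : ℕ) (x : ℝ) : ℂ :=
  (Complex.I * (((x : ℂ) - Complex.I) / ((x : ℂ) + Complex.I))) ^ m

/-- The bilinear form `(f, L₊ g)` of `L₊ = |∇| - 2m / (1 + x²)`. -/
def LplusForm (m : ℕ) (f g : ℝ → ℝ) : ℝ :=
  halfLapForm f g - ∫ x : ℝ, 2 * (m : ℝ) / (1 + x ^ 2) * (f x * g x)

/-- The integral operator
`(R f)(x) = (2π)⁻¹ ∫ |Q_m(x) - Q_m(y)|² / |x - y|² f(y) dy`. -/
def Rop (m : ℕ) (f : ℝ → ℝ) (x : ℝ) : ℝ :=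
  (1 / (2 * Real.pi)) * ∫ y : ℝ, ‖Qmap m x - Qmap m y‖ ^ 2 / (x - y) ^ 2 * f y

/-- The bilinear form `(f, L₋ g)` of `L₋ = L₊ + R`. -/
def LminusForm (m : ℕ) (f g : ℝ → ℝ) : ℝ :=
  LplusForm m f g + ∫ x : ℝ, f x * Rop m g x

/-- Membership in the Sobolev space `H¹(ℝ)`: `f` is in `L²` and has a weak derivative in `L²`. -/
def MemH1 (f : ℝ → ℝ) : Prop :=
  MemLp f 2 ∧ ∃ f' : ℝ → ℝ, MemLp f' 2 ∧
    ∀ η : ℝ → ℝ, ContDiff ℝ (⊤ : ℕ∞) η → HasCompactSupport η →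
      ∫ x : ℝ, f x * deriv η x = - ∫ x : ℝ, f' x * η x

/-- `u ∈ Ḣ^{1/2}` is a weak solution of `L₊ u = E u`, tested against the functions of the form
domain `H^{1/2} = Ḣ^{1/2} ∩ L²` of `L₊`. -/
def SolvesLplus (m : ℕ) (E : ℝ) (u : ℝ → ℝ) : Prop :=
  MemHdotHalf u ∧ ∀ η : ℝ → ℝ, MemHdotHalf η → MemLp η 2 →
    LplusForm m η u = E * ∫ x : ℝ, η x * u x

/-- `u` is an `L²`-eigenfunction, with eigenvalue `E`, of the operator `L₊` with domain `H¹`. -/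
def IsEigenfunction (m : ℕ) (E : ℝ) (u : ℝ → ℝ) : Prop :=
  MemH1 u ∧ ¬ (u =ᵐ[volume] 0) ∧ SolvesLplus m E u

/-- `u` is a zero energy resonance of `L₊`: `L₊ u = 0` with `u ∈ Ḣ^{1/2} ∖ L²`. -/
def IsResonance (m : ℕ) (u : ℝ → ℝ) : Prop :=
  SolvesLplus m 0 u ∧ ¬ MemLp u 2

/-- `φ_0, …, φ_{2m-2}` are `L²`-eigenfunctions of `L₊` with eigenvalues
`E_0 < … < E_{2m-2} < 0`, `φ_{2m-1}` is an `L²`-eigenfunction with eigenvalue `E_{2m-1} = 0`, and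
`χ` is a zero energy resonance. -/
structure IsBoundStateFamily (m : ℕ) (E : Fin (2 * m) → ℝ) (φ : Fin (2 * m) → ℝ → ℝ)
    (χ : ℝ → ℝ) : Prop where
  strictMono : StrictMono E
  neg : ∀ k : Fin (2 * m), (k : ℕ) + 1 < 2 * m → E k < 0
  zero : ∀ k : Fin (2 * m), (k : ℕ) + 1 = 2 * m → E k = 0
  eigen : ∀ k, IsEigenfunction m (E k) (φ k)
  resonance : IsResonance m χ

/-- The `2m + 1` functions `ψ_k`: `ψ_k = φ_k` for `0 ≤ k ≤ 2m - 2`,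
`ψ_{2m-1} = φ_{2m-1} / (1 + x²)` and `ψ_{2m} = χ / (1 + x²)`. -/
def psi (m : ℕ) (φ : Fin (2 * m) → ℝ → ℝ) (χ : ℝ → ℝ) (k : Fin (2 * m + 1)) (x : ℝ) : ℝ :=
  if h : (k : ℕ) < 2 * m then
    if (k : ℕ) + 1 < 2 * m then φ ⟨k, h⟩ x else φ ⟨k, h⟩ x / (1 + x ^ 2)
  else χ x / (1 + x ^ 2)

/-- The orthogonality conditions `∫ ψ_k f dx = 0` for `0 ≤ k ≤ 2m`. -/
def OrthPsi (m : ℕ) (φ : Fin (2 * m) → ℝ → ℝ) (χ f : ℝ → ℝ) : Prop :=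
  ∀ k : Fin (2 * m + 1), ∫ x : ℝ, psi m φ χ k x * f x = 0

end

end HalfWave

/-! Stereographic projection `x = tan (θ / 2)` carries the problem to the circle, where it is
diagonal. The chordal distance on the circle is `2 |x - y| / √((1 + x²)(1 + y²))`, so the Gagliardo
energy is conformally invariant and equals `2π ∑ |n| c n ^ 2` in a real orthonormal basis of
frequencies `n`. The potential `2m / (1 + x²)` is the same conformal factor, so it becomes the
constant `m`. Hence `(f, L₊ f) = 2π ∑ (|n| - m) c n ^ 2` (`hasSum_LplusForm`), and `R` is a sum of
squares, so `L₋ ≥ L₊` (`integral_mul_Rop_nonneg`).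

The orthogonality conditions say exactly that `c n = 0` for `|n| ≤ m`
(`IsBoundStateFamily.integrable_and_orthPsi_iff`). For `|n| ≥ m + 1` one has `|n| - m ≥ |n| / (m +
1)`, with equality at `|n| = m + 1`; this gives both the estimate and its optimality.

What remains is to identify the bound states. The eigenvalue equation refers to `L²(dx)`, not to the
circle, so it is not diagonal. With `u = (1 + cos θ) B(θ)` it becomes a three-term recursion for the
coefficients of `B`, and the factor `|n| - m`, which vanishes at `|n| = m`, decouples the block `|n|
< m`. On this block the recursion is a positive symmetric Jacobi matrix of size `2m - 1`: its
eigenvalues are simple and its eigenvectors are complete (`exists_modes`). Nonnegativity of `L₊` on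
`|n| ≥ m` excludes any further negative eigenfunction (`IsEigenfunction.exists_eq_of_neg`). Zero
energy solutions have only the frequencies `± m`: `sin mθ` vanishes at infinity and is square
integrable, `cos mθ` is the resonance (`SolvesLplus.ae_eq_of_zero`). -/

namespace HalfWave

noncomputable section

/-! ### The Gagliardo energy on the circle -/

/-- Parseval's identity on the circle, as an identity of lower integrals. -/
lemma lintegral_sq_eq_tsum_fourierCoeff {G : UnitAddCircle → ℂ}
    (hG : MemLp G 2 AddCircle.haarAddCircle) :
    ∫⁻ t, ENNReal.ofReal (‖G t‖ ^ 2) ∂AddCircle.haarAddCircle =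
      ∑' n : ℤ, ENNReal.ofReal (‖fourierCoeff G n‖ ^ 2) := by
  have h := hasSum_sq_fourierCoeff hG.toLp
  have hae := hG.coeFn_toLp
  rw [fourierCoeff_congr_ae hae] at h
  have h2 : ∫ t, ‖hG.toLp G t‖ ^ 2 ∂AddCircle.haarAddCircle
      = ∫ t, ‖G t‖ ^ 2 ∂AddCircle.haarAddCircle :=
    integral_congr_ae (hae.mono fun t ht => by simp only [ht])
  rw [h2] at h
  rw [← ofReal_integral_eq_lintegral_ofReal, ← h.tsum_eq,
    ENNReal.ofReal_tsum_of_nonneg (fun n => by positivity) h.summable]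
  · exact (memLp_two_iff_integrable_sq_norm hG.1).1 hG
  · exact Filter.Eventually.of_forall fun t => by positivity

lemma fourierCoeff_comp_add_right {G : UnitAddCircle → ℂ} (h : UnitAddCircle) (n : ℤ) :
    fourierCoeff (fun t => G (t + h)) n = fourier n h * fourierCoeff G n := by
  unfold fourierCoeff
  rw [← integral_const_mul, ← integral_add_right_eq_self
    (μ := AddCircle.haarAddCircle) (fun t => fourier n h * (fourier (-n) t • G t)) h]
  congr 1
  ext t
  have : (fourier n h : ℂ) * fourier (-n) (t + h) = fourier (-n) t := by
    rw [fourier_neg, fourier_neg, fourier_apply, fourier_apply, fourier_apply, smul_add,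
      AddCircle.toCircle_add, Circle.coe_mul, map_mul]
    have := Complex.mul_conj ((AddCircle.toCircle (n • h) : Circle) : ℂ)
    rw [Complex.normSq_eq_norm_sq, Circle.norm_coe, one_pow, Complex.ofReal_one] at this
    linear_combination (starRingEnd ℂ) ((AddCircle.toCircle (n • t) : Circle) : ℂ) * this
  simp only [smul_eq_mul]
  linear_combination -G (t + h) * this

lemma fourier_one_eq_one_iff (h : UnitAddCircle) : (fourier 1 h : ℂ) = 1 ↔ h = 0 := by
  rw [fourier_one]
  constructor
  · intro hh
    apply AddCircle.injective_toCircle (T := 1) one_ne_zero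
    ext
    rw [hh]; simp
  · rintro rfl; simp

lemma fourier_natCast (n : ℕ) (h : UnitAddCircle) : (fourier (n : ℤ) h : ℂ) = fourier 1 h ^ n := by
  induction n with
  | zero => simp
  | succ k ih => rw [pow_succ, ← ih]; push_cast; rw [fourier_add]

/-- The quotient is a geometric sum of the characters `0, …, n - 1`, and Parseval counts them. This
integral is the source of the multiplier `|n|`. -/
lemma lintegral_fejer_nat (n : ℕ) :
    ∫⁻ h : UnitAddCircle, ENNReal.ofReal (‖(fourier (n : ℤ) h : ℂ) - 1‖ ^ 2 /
      ‖(fourier 1 h : ℂ) - 1‖ ^ 2) ∂AddCircle.haarAddCircle = n := by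
  set G : UnitAddCircle → ℂ := ∑ j ∈ Finset.range n, ⇑(fourier (T := 1) (j : ℤ)) with hG
  have hint : ∀ j : ℕ, Integrable (⇑(fourier (T := 1) (j : ℤ))) AddCircle.haarAddCircle :=
    fun j => (ContinuousMap.continuous _).integrable_of_hasCompactSupport
      (HasCompactSupport.of_compactSpace _)
  have hG2 : MemLp G 2 AddCircle.haarAddCircle := by
    have hc : Continuous G := by
      have : G = fun t => ∑ j ∈ Finset.range n, (fourier (j : ℤ) t : ℂ) := by
        ext t; simp [hG]
      rw [this]
      exact continuous_finsetSum _ fun j _ => (fourier (T := 1) (j : ℤ)).continuous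
    exact hc.memLp_of_hasCompactSupport (HasCompactSupport.of_compactSpace _)
  have hne : ∀ᵐ h : UnitAddCircle ∂AddCircle.haarAddCircle, h ≠ 0 := by
    rw [ae_iff]
    have h := AddCircle.volume_eq_smul_haarAddCircle (T := 1)
    simp only [ENNReal.ofReal_one, one_smul] at h
    rw [← h]
    have h2 := AddCircle.volume_closedBall (T := 1) (x := 0) 0
    simpa using h2
  have h1 : ∫⁻ h : UnitAddCircle, ENNReal.ofReal (‖(fourier (n : ℤ) h : ℂ) - 1‖ ^ 2 /
      ‖(fourier 1 h : ℂ) - 1‖ ^ 2) ∂AddCircle.haarAddCircle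
      = ∫⁻ h, ENNReal.ofReal (‖G h‖ ^ 2) ∂AddCircle.haarAddCircle := by
    refine lintegral_congr_ae (hne.mono fun h hh => ?_)
    have hz : (fourier 1 h : ℂ) - 1 ≠ 0 := fun h0 => hh ((fourier_one_eq_one_iff h).1 (sub_eq_zero.1 h0))
    have : G h = ∑ j ∈ Finset.range n, (fourier 1 h : ℂ) ^ j := by
      simp only [hG, Finset.sum_apply, fourier_natCast]
    simp only
    rw [fourier_natCast, this, ← div_pow, ← norm_div, ← geom_sum_eq (sub_ne_zero.1 hz)]
  rw [h1, lintegral_sq_eq_tsum_fourierCoeff hG2]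
  have hco : ∀ k : ℤ, ‖fourierCoeff G k‖ ^ 2 =
      if k ∈ (Finset.range n).image (fun j : ℕ => (j : ℤ)) then (1 : ℝ) else 0 := by
    intro k
    rw [hG, fourierCoeff.sum _ _ (fun j _ => hint j)]
    simp only [Finset.sum_apply, fourierCoeff_fourier]
    by_cases hk : k ∈ (Finset.range n).image (fun j : ℕ => (j : ℤ))
    · rw [if_pos hk]
      obtain ⟨j, hj, rfl⟩ := Finset.mem_image.1 hk
      rw [Finset.sum_eq_single j]
      · simp
      · intro b _ hb
        rw [Pi.single_apply, if_neg]
        simpa using hb.symm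
      · intro h; exact absurd hj h
    · rw [if_neg hk, Finset.sum_eq_zero]
      · simp
      · intro j hj
        rw [Pi.single_apply, if_neg]
        rintro rfl
        exact hk (Finset.mem_image_of_mem _ hj)
  simp only [hco]
  rw [tsum_eq_sum (s := (Finset.range n).image (fun j : ℕ => (j : ℤ)))]
  · rw [Finset.sum_congr rfl (g := fun _ => (1 : ENNReal)) (fun k hk => by rw [if_pos hk]; simp)]
    rw [Finset.sum_const, Finset.card_image_of_injective _ Nat.cast_injective]
    simp
  · intro k hk; rw [if_neg hk]; simp

lemma lintegral_fejer (n : ℤ) :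
    ∫⁻ h : UnitAddCircle, ENNReal.ofReal (‖(fourier n h : ℂ) - 1‖ ^ 2 /
      ‖(fourier 1 h : ℂ) - 1‖ ^ 2) ∂AddCircle.haarAddCircle = ENNReal.ofReal |(n : ℝ)| := by
  obtain ⟨k, rfl | rfl⟩ := n.eq_nat_or_neg
  · rw [lintegral_fejer_nat]; simp
  · have : ∀ h : UnitAddCircle, ‖(fourier (-(k : ℤ)) h : ℂ) - 1‖ = ‖(fourier (k : ℤ) h : ℂ) - 1‖ := by
      intro h
      rw [fourier_neg, ← Complex.norm_conj]
      simp
    simp only [this]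
    rw [lintegral_fejer_nat]; simp

/-- Substitute `x = y + h`. The chord then depends on `h` alone, and `F (· + h) - F` has
coefficients `(fourier n h - 1)` times those of `F`; Parseval in `y` and `lintegral_fejer` in `h`
finish. Lower integrals make Tonelli unconditional, so infinite energy is included. -/
lemma lintegral_gagliardo_circle_of_measurable {F : UnitAddCircle → ℝ} (hm : Measurable F)
    (hF : MemLp F 2 AddCircle.haarAddCircle) :
    ∫⁻ p : UnitAddCircle × UnitAddCircle, ENNReal.ofReal ((F p.1 - F p.2) ^ 2 /
        ‖(fourier 1 p.1 : ℂ) - fourier 1 p.2‖ ^ 2)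
        ∂(AddCircle.haarAddCircle.prod AddCircle.haarAddCircle) =
      ∑' n : ℤ, ENNReal.ofReal (|(n : ℝ)| * ‖fourierCoeff (fun t => (F t : ℂ)) n‖ ^ 2) := by
  have hm1 : Measurable (fun t : UnitAddCircle => (fourier 1 t : ℂ)) :=
    (ContinuousMap.continuous _).measurable
  have hmk : ∀ n : ℤ, Measurable (fun h : UnitAddCircle => ENNReal.ofReal
      (‖(fourier n h : ℂ) - 1‖ ^ 2 / ‖(fourier 1 h : ℂ) - 1‖ ^ 2)) := fun n => by
    have : Measurable (fun t : UnitAddCircle => (fourier n t : ℂ)) :=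
      (ContinuousMap.continuous _).measurable
    fun_prop
  rw [lintegral_prod_symm' _ (by fun_prop)]
  have h1 : ∀ y, ∫⁻ x, ENNReal.ofReal ((F x - F y) ^ 2 /
        ‖(fourier 1 x : ℂ) - fourier 1 y‖ ^ 2) ∂AddCircle.haarAddCircle
      = ∫⁻ x, ENNReal.ofReal ((F (y + x) - F y) ^ 2 /
        ‖(fourier 1 (y + x) : ℂ) - fourier 1 y‖ ^ 2) ∂AddCircle.haarAddCircle := fun y =>
    (lintegral_add_left_eq_self (μ := AddCircle.haarAddCircle) _ y).symm
  simp only [h1]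
  rw [lintegral_lintegral_swap (by fun_prop)]
  have h2 : ∀ h : UnitAddCircle, ∫⁻ y, ENNReal.ofReal ((F (y + h) - F y) ^ 2 /
        ‖(fourier 1 (y + h) : ℂ) - fourier 1 y‖ ^ 2) ∂AddCircle.haarAddCircle
      = ∑' n : ℤ, ENNReal.ofReal (‖fourierCoeff (fun t => (F t : ℂ)) n‖ ^ 2) *
        ENNReal.ofReal (‖(fourier n h : ℂ) - 1‖ ^ 2 / ‖(fourier 1 h : ℂ) - 1‖ ^ 2) := by
    intro h
    have hFt : MemLp (fun t => F (t + h)) 2 AddCircle.haarAddCircle :=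
      hF.comp_measurePreserving (measurePreserving_add_right _ h)
    have hG : MemLp (fun t => ((F (t + h) : ℝ) : ℂ) - (F t : ℂ)) 2 AddCircle.haarAddCircle :=
      (hFt.ofReal (K := ℂ)).sub (hF.ofReal (K := ℂ))
    have hco : ∀ n, fourierCoeff (fun t => ((F (t + h) : ℝ) : ℂ) - (F t : ℂ)) n
        = (fourier n h - 1) * fourierCoeff (fun t => (F t : ℂ)) n := by
      intro n
      have e1 : (fun t => ((F (t + h) : ℝ) : ℂ) - (F t : ℂ)) =
        (fun t => ((F (t + h) : ℝ) : ℂ)) + fun t => ((-1 : ℂ) * (F t : ℂ)) := by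
          ext t; simp; ring
      rw [e1, fourierCoeff.add, Pi.add_apply, fourierCoeff_comp_add_right (G := fun t => (F t : ℂ)) h n,
        fourierCoeff.const_mul]
      · ring
      · exact (hFt.ofReal (K := ℂ)).integrable (by norm_num)
      · exact ((hF.ofReal (K := ℂ)).integrable (by norm_num)).const_mul _
    have hp := lintegral_sq_eq_tsum_fourierCoeff hG
    have h3 : ∀ y, ENNReal.ofReal ((F (y + h) - F y) ^ 2 /
        ‖(fourier 1 (y + h) : ℂ) - fourier 1 y‖ ^ 2) =
        ENNReal.ofReal (1 / ‖(fourier 1 h : ℂ) - 1‖ ^ 2) *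
          ENNReal.ofReal (‖((F (y + h) : ℝ) : ℂ) - (F y : ℂ)‖ ^ 2) := by
      intro y
      rw [← ENNReal.ofReal_mul (by positivity)]
      congr 1
      have : (fourier 1 (y + h) : ℂ) - fourier 1 y = fourier 1 y * (fourier 1 h - 1) := by
        simp only [fourier_one, AddCircle.toCircle_add, Circle.coe_mul]; ring
      rw [this, norm_mul, fourier_one, Circle.norm_coe, one_mul, ← Complex.ofReal_sub,
        Complex.norm_real, Real.norm_eq_abs, sq_abs]
      ring
    simp only [h3]
    rw [lintegral_const_mul _ (by fun_prop), hp, ← ENNReal.tsum_mul_left]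
    congr 1
    ext n
    rw [hco, norm_mul, ← ENNReal.ofReal_mul (by positivity), ← ENNReal.ofReal_mul (by positivity)]
    congr 1
    ring
  simp only [h2]
  rw [lintegral_tsum fun n => ((hmk n).const_mul _).aemeasurable]
  congr 1
  ext n
  rw [lintegral_const_mul _ (hmk n), lintegral_fejer, ← ENNReal.ofReal_mul (by positivity), mul_comm]

/-- The Gagliardo energy on the circle in terms of Fourier coefficients. -/
lemma lintegral_gagliardo_circle {F : UnitAddCircle → ℝ}
    (hF : MemLp F 2 AddCircle.haarAddCircle) :
    ∫⁻ p : UnitAddCircle × UnitAddCircle, ENNReal.ofReal ((F p.1 - F p.2) ^ 2 /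
        ‖(fourier 1 p.1 : ℂ) - fourier 1 p.2‖ ^ 2)
        ∂(AddCircle.haarAddCircle.prod AddCircle.haarAddCircle) =
      ∑' n : ℤ, ENNReal.ofReal (|(n : ℝ)| * ‖fourierCoeff (fun t => (F t : ℂ)) n‖ ^ 2) := by
  obtain ⟨F', hF', hae⟩ := hF.1
  have h := lintegral_gagliardo_circle_of_measurable hF'.measurable ((memLp_congr_ae hae).1 hF)
  have hc : fourierCoeff (fun t => (F' t : ℂ)) = fourierCoeff (fun t => (F t : ℂ)) :=
    fourierCoeff_congr_ae (hae.mono fun t ht => by simp only [ht])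
  rw [hc] at h
  rw [← h]
  refine lintegral_congr_ae ?_
  filter_upwards [Measure.quasiMeasurePreserving_fst.ae hae,
    Measure.quasiMeasurePreserving_snd.ae hae] with p h1 h2
  rw [h1, h2]

/-! ### Stereographic projection between the line and the circle -/

/-- The Cauchy probability measure `dx / (π (1 + x²))`, the pullback of the normalized arc length
of the circle under stereographic projection. -/
def cauchyProb : Measure ℝ :=
  (volume : Measure ℝ).withDensity fun x => ENNReal.ofReal (1 / (Real.pi * (1 + x ^ 2)))

lemma measurable_cauchyDensity :
    Measurable fun x : ℝ => ENNReal.ofReal (1 / (Real.pi * (1 + x ^ 2))) := by fun_prop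

lemma one_add_sq_pos (x : ℝ) : 0 < 1 + x ^ 2 := by positivity

/-- Inverse stereographic projection `x ↦ 2 arctan x`, in units of a full turn. -/
def toAddCircle (x : ℝ) : UnitAddCircle := ((Real.arctan x / Real.pi : ℝ) : UnitAddCircle)

lemma measurePreserving_arctan_div_pi :
    MeasurePreserving (fun x : ℝ => Real.arctan x / Real.pi) cauchyProb
      (volume.restrict (Set.Ioc (-(1 / 2)) (-(1 / 2) + 1))) := by
  have hm : Measurable (fun x : ℝ => Real.arctan x / Real.pi) := by fun_prop
  refine ⟨hm, ?_⟩
  have himg : (fun x : ℝ => Real.arctan x / Real.pi) '' Set.univ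
      = Set.Ioo (-(1 / 2)) (-(1 / 2) + 1) := by
    rw [Set.image_univ]
    ext y
    simp only [Set.mem_range, Set.mem_Ioo]
    constructor
    · rintro ⟨x, rfl⟩
      have h1 := Real.neg_pi_div_two_lt_arctan x
      have h2 := Real.arctan_lt_pi_div_two x
      constructor
      · rw [lt_div_iff₀ Real.pi_pos]; linarith
      · rw [div_lt_iff₀ Real.pi_pos]; linarith
    · rintro ⟨h1, h2⟩
      refine ⟨Real.tan (y * Real.pi), ?_⟩
      rw [Real.arctan_tan]
      · field_simp
      · nlinarith [Real.pi_pos]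
      · nlinarith [Real.pi_pos]
  ext s hs
  rw [Measure.map_apply hm hs, ← restrict_Ioo_eq_restrict_Ioc, ← lintegral_indicator_one hs, ← himg,
    lintegral_image_eq_lintegral_abs_deriv_mul (f' := fun x => 1 / (1 + x ^ 2) / Real.pi)
      MeasurableSet.univ
      (fun x _ => ((Real.hasDerivAt_arctan x).div_const Real.pi).hasDerivWithinAt)
      (fun x _ y _ h => Real.arctan_injective (by
        have := Real.pi_ne_zero
        simpa [div_left_inj' this] using h)), Measure.restrict_univ, cauchyProb,
    withDensity_apply _ (hm hs), ← lintegral_indicator (hm hs)]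
  refine lintegral_congr fun x => ?_
  have h1 : |1 / (1 + x ^ 2) / Real.pi| = 1 / (Real.pi * (1 + x ^ 2)) := by
    rw [abs_of_nonneg (by have := Real.pi_pos; positivity), div_div, mul_comm]
  rw [h1]
  by_cases hx : Real.arctan x / Real.pi ∈ s
  · simp [Set.indicator, hx]
  · simp [Set.indicator, hx]

lemma measurePreserving_toAddCircle :
    MeasurePreserving toAddCircle cauchyProb AddCircle.haarAddCircle := by
  have h := (AddCircle.measurePreserving_mk (1 : ℝ) (-(1 / 2))).comp
    measurePreserving_arctan_div_pi
  have h2 := AddCircle.volume_eq_smul_haarAddCircle (T := 1)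
  simp only [ENNReal.ofReal_one, one_smul] at h2
  rw [← h2]
  exact h

instance : IsProbabilityMeasure cauchyProb :=
  ⟨by simpa using measurePreserving_toAddCircle.measure_preimage MeasurableSet.univ.nullMeasurableSet⟩

/-- Stereographic projection on the circle, a left inverse of `toAddCircle`. -/
def ofAddCircle : UnitAddCircle → ℝ :=
  Function.Periodic.lift (f := fun t : ℝ => Real.tan (t * Real.pi)) (c := 1) (fun t => by
    simp only [add_mul, one_mul]; exact Real.tan_periodic _)

lemma ofAddCircle_toAddCircle (x : ℝ) : ofAddCircle (toAddCircle x) = x := by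
  have : ofAddCircle (toAddCircle x) = Real.tan (Real.arctan x / Real.pi * Real.pi) := rfl
  rw [this, div_mul_cancel₀ _ Real.pi_ne_zero, Real.tan_arctan]

lemma measurableEmbedding_toAddCircle : MeasurableEmbedding toAddCircle :=
  measurePreserving_toAddCircle.measurable.measurableEmbedding
    (Function.LeftInverse.injective ofAddCircle_toAddCircle)

lemma fourier_toAddCircle (n : ℤ) (x : ℝ) : (fourier n (toAddCircle x) : ℂ)
    = Complex.exp (((2 * n * Real.arctan x : ℝ) : ℂ) * Complex.I) := by
  rw [toAddCircle, fourier_coe_apply]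
  congr 1
  have : (Real.pi : ℂ) ≠ 0 := by exact_mod_cast Real.pi_ne_zero
  push_cast
  field_simp

/-- The phase `(1 + i x) / (1 - i x) = exp (2 i arctan x)`. -/
lemma fourier_one_toAddCircle (x : ℝ) : (fourier 1 (toAddCircle x) : ℂ)
    = (1 + x * Complex.I) / (1 - x * Complex.I) := by
  rw [fourier_toAddCircle]
  have hne : (1 : ℂ) - x * Complex.I ≠ 0 := by
    intro h; have := congrArg Complex.re h; simp at this
  have h1 : ((2 * (1 : ℤ) * Real.arctan x : ℝ) : ℂ) * Complex.I
    = ((Real.arctan x : ℝ) : ℂ) * Complex.I + ((Real.arctan x : ℝ) : ℂ) * Complex.I := by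
    push_cast; ring
  have hs : (Real.sqrt (1 + x ^ 2)) ^ 2 = 1 + x ^ 2 := Real.sq_sqrt (one_add_sq_pos x).le
  have hs0 : Real.sqrt (1 + x ^ 2) ≠ 0 := (Real.sqrt_pos.2 (one_add_sq_pos x)).ne'
  rw [h1, Complex.exp_add, Complex.exp_mul_I, ← Complex.ofReal_cos, ← Complex.ofReal_sin,
    Real.cos_arctan, Real.sin_arctan, eq_div_iff hne]
  have hsC : ((Real.sqrt (1 + x ^ 2) : ℝ) : ℂ) ^ 2 = 1 + (x : ℂ) ^ 2 := by exact_mod_cast hs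
  have hs0C : ((Real.sqrt (1 + x ^ 2) : ℝ) : ℂ) ≠ 0 := by exact_mod_cast hs0
  push_cast
  field_simp
  rw [hsC]
  ring_nf
  simp only [Complex.I_sq, show Complex.I ^ 3 = -Complex.I by
    rw [pow_succ, Complex.I_sq]; ring]
  ring

/-- The conformal factor here cancels the two Cauchy densities in `lintegral_gagliardo_line`, up to
`4π²`. -/
lemma norm_fourier_one_sub_sq (x y : ℝ) :
    ‖(fourier 1 (toAddCircle x) : ℂ) - fourier 1 (toAddCircle y)‖ ^ 2 =
      4 * (x - y) ^ 2 / ((1 + x ^ 2) * (1 + y ^ 2)) := by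
  have hne : ∀ x : ℝ, (1 : ℂ) - x * Complex.I ≠ 0 := by
    intro x h; have := congrArg Complex.re h; simp at this
  have hn : ∀ x : ℝ, ‖(1 : ℂ) - x * Complex.I‖ ^ 2 = 1 + x ^ 2 := by
    intro x; rw [← Complex.normSq_eq_norm_sq, Complex.normSq_apply]; simp; ring
  rw [fourier_one_toAddCircle, fourier_one_toAddCircle, div_sub_div _ _ (hne x) (hne y), norm_div,
    div_pow, norm_mul, mul_pow, hn, hn]
  congr 1
  have : (1 + (x : ℂ) * Complex.I) * (1 - y * Complex.I) - (1 - x * Complex.I) * (1 + y * Complex.I)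
      = ((2 * (x - y) : ℝ) : ℂ) * Complex.I := by push_cast; ring
  rw [this, norm_mul, Complex.norm_I, mul_one, Complex.norm_real, Real.norm_eq_abs, sq_abs]
  ring

/-! ### Integrals against the Cauchy measure -/

lemma integrable_cauchyProb_iff {f : ℝ → ℝ} :
    Integrable f cauchyProb ↔ Integrable (fun x => f x / (1 + x ^ 2)) := by
  rw [cauchyProb, integrable_withDensity_iff_integrable_smul' measurable_cauchyDensity
    (Filter.Eventually.of_forall fun x => ENNReal.ofReal_lt_top)]
  rw [← integrable_const_mul_iff (c := Real.pi⁻¹) (by simp [Real.pi_ne_zero]) (fun x => f x / (1 + x ^ 2))]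
  refine iff_of_eq (congrArg (fun g => Integrable g volume) (funext fun x => ?_))
  rw [ENNReal.toReal_ofReal (by have := Real.pi_pos; positivity), smul_eq_mul]
  field_simp

lemma integral_cauchyProb (f : ℝ → ℝ) :
    ∫ x, f x ∂cauchyProb = Real.pi⁻¹ * ∫ x, f x / (1 + x ^ 2) := by
  rw [cauchyProb, integral_withDensity_eq_integral_toReal_smul measurable_cauchyDensity
    (Filter.Eventually.of_forall fun x => ENNReal.ofReal_lt_top), ← integral_const_mul]
  congr 1
  ext x
  rw [ENNReal.toReal_ofReal (by have := Real.pi_pos; positivity), smul_eq_mul]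
  field_simp

lemma cauchyProb_absolutelyContinuous : cauchyProb ≪ volume :=
  withDensity_absolutelyContinuous _ _

lemma absolutelyContinuous_cauchyProb : (volume : Measure ℝ) ≪ cauchyProb :=
  withDensity_absolutelyContinuous' measurable_cauchyDensity.aemeasurable
    (Filter.Eventually.of_forall fun x => by
      have := Real.pi_pos
      have := one_add_sq_pos x
      simp only [ne_eq, ENNReal.ofReal_eq_zero, not_le]
      positivity)

/-- The Gagliardo energy on the line, in terms of the Cauchy measure. -/
lemma lintegral_gagliardo_line {f : ℝ → ℝ} (hf : AEMeasurable f) :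
    ∫⁻ p : ℝ × ℝ, ENNReal.ofReal ((f p.1 - f p.2) ^ 2 / (p.1 - p.2) ^ 2) =
      ENNReal.ofReal (4 * Real.pi ^ 2) * ∫⁻ p : ℝ × ℝ, ENNReal.ofReal ((f p.1 - f p.2) ^ 2 /
        ‖(fourier 1 (toAddCircle p.1) : ℂ) - fourier 1 (toAddCircle p.2)‖ ^ 2)
        ∂(cauchyProb.prod cauchyProb) := by
  have hm1 : Measurable (fun x : ℝ => (fourier 1 (toAddCircle x) : ℂ)) :=
    (ContinuousMap.continuous _).measurable.comp measurePreserving_toAddCircle.measurable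
  have hf1 : AEMeasurable (fun p : ℝ × ℝ => f p.1) (volume.prod volume) :=
    hf.comp_quasiMeasurePreserving Measure.quasiMeasurePreserving_fst
  have hf2 : AEMeasurable (fun p : ℝ × ℝ => f p.2) (volume.prod volume) :=
    hf.comp_quasiMeasurePreserving Measure.quasiMeasurePreserving_snd
  have hg : AEMeasurable (fun p : ℝ × ℝ => ENNReal.ofReal ((f p.1 - f p.2) ^ 2 /
      ‖(fourier 1 (toAddCircle p.1) : ℂ) - fourier 1 (toAddCircle p.2)‖ ^ 2))
      (volume.prod volume) :=
    (((hf1.sub hf2).pow_const 2).div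
      ((((hm1.comp measurable_fst).sub (hm1.comp measurable_snd)).norm.pow_const 2)
        ).aemeasurable).ennreal_ofReal
  rw [cauchyProb, prod_withDensity measurable_cauchyDensity measurable_cauchyDensity,
    lintegral_withDensity_eq_lintegral_mul₀ (by fun_prop) hg, ← lintegral_const_mul'' _
      (AEMeasurable.mul (by fun_prop) hg)]
  · refine lintegral_congr fun p => ?_
    have := Real.pi_pos
    have h1 := one_add_sq_pos p.1
    have h2 := one_add_sq_pos p.2
    rw [Pi.mul_apply, ← ENNReal.ofReal_mul (by positivity), ← ENNReal.ofReal_mul (by positivity),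
      ← ENNReal.ofReal_mul (by positivity), norm_fourier_one_sub_sq]
    congr 1
    rcases eq_or_ne p.1 p.2 with h | h
    · simp [h]
    · have h3 := sub_ne_zero.2 h
      field_simp

/-! ### The Hartley basis -/

/-- The Hartley functions `cos nθ + sin nθ`, `θ = 2 arctan x`: a real orthonormal basis of
`L²(cauchyProb)` indexed by `ℤ`. -/
def cas (n : ℤ) (x : ℝ) : ℝ :=
  Real.cos (2 * n * Real.arctan x) + Real.sin (2 * n * Real.arctan x)

/-- The coefficients of a function with respect to the Hartley functions. -/
def hart (f : ℝ → ℝ) (n : ℤ) : ℝ := ∫ x, f x * cas n x ∂cauchyProb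

@[fun_prop]
lemma continuous_cas (n : ℤ) : Continuous (cas n) := by unfold cas; fun_prop

lemma abs_cas_le (n : ℤ) (x : ℝ) : |cas n x| ≤ 2 := by
  unfold cas
  refine (abs_add_le _ _).trans ?_
  linarith [Real.abs_cos_le_one (2 * n * Real.arctan x), Real.abs_sin_le_one (2 * n * Real.arctan x)]

lemma integrable_mul_cas {μ : Measure ℝ} {f : ℝ → ℝ} (hf : Integrable f μ) (n : ℤ) :
    Integrable (fun x => f x * cas n x) μ :=
  hf.mul_bdd (c := 2) (by fun_prop) (Filter.Eventually.of_forall fun x => abs_cas_le n x)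

lemma memLp_cas (n : ℤ) {p : ENNReal} : MemLp (cas n) p cauchyProb :=
  MemLp.of_bound (by fun_prop) 2 (Filter.Eventually.of_forall fun x => abs_cas_le n x)

/-! ### Linearity of the coefficients -/

lemma hart_add {f g : ℝ → ℝ} (hf : Integrable f cauchyProb) (hg : Integrable g cauchyProb)
    (n : ℤ) : hart (fun x => f x + g x) n = hart f n + hart g n := by
  unfold hart
  rw [← integral_add (integrable_mul_cas hf n) (integrable_mul_cas hg n)]
  simp only [add_mul]

lemma hart_const_mul (c : ℝ) (f : ℝ → ℝ) (n : ℤ) :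
    hart (fun x => c * f x) n = c * hart f n := by
  unfold hart
  rw [← integral_const_mul]
  simp only [mul_assoc]

lemma hart_sub {f g : ℝ → ℝ} (hf : Integrable f cauchyProb) (hg : Integrable g cauchyProb)
    (n : ℤ) : hart (fun x => f x - g x) n = hart f n - hart g n := by
  unfold hart
  rw [← integral_sub (integrable_mul_cas hf n) (integrable_mul_cas hg n)]
  simp only [sub_mul]

lemma hart_congr {f g : ℝ → ℝ} (h : f =ᵐ[volume] g) : hart f = hart g := by
  ext n
  exact integral_congr_ae ((cauchyProb_absolutelyContinuous.ae_eq h).mono fun x hx => by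
    simp only [hx])

/-! ### Relation to Fourier coefficients -/

/-- The Fourier coefficients of `f` carried to the circle. -/
def fourierCoeffLine (f : ℝ → ℝ) (n : ℤ) : ℂ :=
  fourierCoeff (fun t : UnitAddCircle => (f (ofAddCircle t) : ℂ)) n

lemma fourierCoeffLine_eq (f : ℝ → ℝ) (n : ℤ) : fourierCoeffLine f n
    = ∫ x, (fourier (-n) (toAddCircle x) : ℂ) * f x ∂cauchyProb := by
  unfold fourierCoeffLine fourierCoeff
  rw [← measurePreserving_toAddCircle.integral_comp measurableEmbedding_toAddCircle]
  simp only [ofAddCircle_toAddCircle, smul_eq_mul]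

lemma hart_eq_re_sub_im {f : ℝ → ℝ} (hf : Integrable f cauchyProb) (n : ℤ) :
    hart f n = (fourierCoeffLine f n).re - (fourierCoeffLine f n).im := by
  have hint : Integrable (fun x => (fourier (-n) (toAddCircle x) : ℂ) * f x) cauchyProb := by
    refine hf.ofReal.bdd_mul (c := 1) ?_ (Filter.Eventually.of_forall fun x => ?_)
    · exact ((ContinuousMap.continuous _).measurable.comp
        measurePreserving_toAddCircle.measurable).aestronglyMeasurable
    · rw [fourier_apply, Circle.norm_coe]
  have h := (Complex.reCLM - Complex.imCLM).integral_comp_comm hint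
  rw [← fourierCoeffLine_eq] at h
  rw [show (fourierCoeffLine f n).re - (fourierCoeffLine f n).im
    = (Complex.reCLM - Complex.imCLM) (fourierCoeffLine f n) from rfl, ← h]
  unfold hart
  congr 1
  ext x
  rw [fourier_toAddCircle, cas]
  simp only [sub_apply, Complex.reCLM_apply, Complex.imCLM_apply,
    Complex.mul_re, Complex.mul_im, Complex.ofReal_re, Complex.ofReal_im,
    Complex.exp_ofReal_mul_I_re, Complex.exp_ofReal_mul_I_im]
  push_cast
  rw [show 2 * -(n : ℝ) * Real.arctan x = -(2 * n * Real.arctan x) by ring, Real.cos_neg,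
    Real.sin_neg]
  ring

lemma fourierCoeffLine_neg (f : ℝ → ℝ) (n : ℤ) :
    fourierCoeffLine f (-n) = (starRingEnd ℂ) (fourierCoeffLine f n) := by
  rw [fourierCoeffLine_eq, fourierCoeffLine_eq, ← integral_conj]
  congr 1
  ext x
  rw [fourier_neg, map_mul, Complex.conj_ofReal]

/-- A Hartley coefficient is `Re - Im` of the Fourier coefficient, and real functions have conjugate
coefficients at `± n`. So the squares agree only after adding `n` and `-n`, which is why the weight
must be even. -/
lemma tsum_even_weight_fourierCoeffLine {f : ℝ → ℝ} (hf : Integrable f cauchyProb)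
    {w : ℤ → ℝ} (hw : ∀ n, 0 ≤ w n) (heven : ∀ n, w (-n) = w n) :
    ∑' n, ENNReal.ofReal (w n * ‖fourierCoeffLine f n‖ ^ 2) =
      ∑' n, ENNReal.ofReal (w n * hart f n ^ 2) := by
  have key : ∀ a : ℤ → ENNReal, 2 * ∑' n, a n = ∑' n, (a n + a (-n)) := by
    intro a
    rw [ENNReal.tsum_add, two_mul]
    congr 1
    exact ((Equiv.neg ℤ).tsum_eq a).symm
  have h2 : (2 : ENNReal) ≠ 0 := by norm_num
  rw [← ENNReal.mul_right_inj h2 (by norm_num), key, key]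
  congr 1
  ext n
  have := hw n
  rw [← ENNReal.ofReal_add (by have := hw n; positivity) (by have := hw (-n); positivity),
    ← ENNReal.ofReal_add (by have := hw n; positivity) (by have := hw (-n); positivity),
    heven, hart_eq_re_sub_im hf, hart_eq_re_sub_im hf, fourierCoeffLine_neg,
    RCLike.norm_conj, ← Complex.normSq_eq_norm_sq, Complex.normSq_apply]
  congr 1
  simp only [Complex.conj_re, Complex.conj_im]
  ring

lemma memLp_comp_ofAddCircle {f : ℝ → ℝ} (hf : MemLp f 2 cauchyProb) :
    MemLp (fun t => f (ofAddCircle t)) 2 AddCircle.haarAddCircle := by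
  rw [← measurePreserving_toAddCircle.map_eq,
    measurableEmbedding_toAddCircle.memLp_map_measure_iff]
  simpa [Function.comp_def, ofAddCircle_toAddCircle] using hf

lemma hasSum_of_lintegral_eq_tsum {α ι : Type*} [MeasurableSpace α] {μ : Measure α} {g : α → ℝ}
    {a : ι → ℝ} (hg0 : ∀ x, 0 ≤ g x) (ha0 : ∀ i, 0 ≤ a i) (hg : Integrable g μ)
    (h : ∫⁻ x, ENNReal.ofReal (g x) ∂μ = ∑' i, ENNReal.ofReal (a i)) :
    HasSum a (∫ x, g x ∂μ) := by
  have h1 := ofReal_integral_eq_lintegral_ofReal hg (Filter.Eventually.of_forall hg0)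
  rw [h] at h1
  have hne : ∑' i, ENNReal.ofReal (a i) ≠ ⊤ := by rw [← h1]; exact ENNReal.ofReal_ne_top
  have hs : Summable a := by
    have := ENNReal.summable_toReal hne
    simpa only [ENNReal.toReal_ofReal (ha0 _)] using this
  rw [← ENNReal.ofReal_tsum_of_nonneg ha0 hs] at h1
  have h2 := (ENNReal.ofReal_eq_ofReal_iff (integral_nonneg hg0) (tsum_nonneg ha0)).1 h1
  rw [h2]
  exact hs.hasSum

/-! ### Parseval's identity -/

lemma lintegral_sq_eq_tsum_hart {f : ℝ → ℝ} (hf : MemLp f 2 cauchyProb) :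
    ∫⁻ x, ENNReal.ofReal (f x ^ 2) ∂cauchyProb = ∑' n, ENNReal.ofReal (hart f n ^ 2) := by
  have h1 := lintegral_sq_eq_tsum_fourierCoeff ((memLp_comp_ofAddCircle hf).ofReal (K := ℂ))
  rw [← measurePreserving_toAddCircle.lintegral_comp_emb measurableEmbedding_toAddCircle] at h1
  have h2 := tsum_even_weight_fourierCoeffLine (hf.integrable (by norm_num)) (w := fun _ => 1)
    (fun _ => zero_le_one) (fun _ => rfl)
  simp only [one_mul] at h2
  rw [← h2]
  simp only [ofAddCircle_toAddCircle, RCLike.norm_ofReal, sq_abs] at h1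
  exact h1

lemma hasSum_hart_sq {f : ℝ → ℝ} (hf : MemLp f 2 cauchyProb) :
    HasSum (fun n => hart f n ^ 2) (∫ x, f x ^ 2 ∂cauchyProb) :=
  hasSum_of_lintegral_eq_tsum (fun _ => sq_nonneg _) (fun _ => sq_nonneg _) hf.integrable_sq
    (lintegral_sq_eq_tsum_hart hf)

lemma hasSum_hart_mul {f g : ℝ → ℝ} (hf : MemLp f 2 cauchyProb) (hg : MemLp g 2 cauchyProb) :
    HasSum (fun n => hart f n * hart g n) (∫ x, f x * g x ∂cauchyProb) := by
  have h1 := hasSum_hart_sq (f := fun x => f x + g x) (hf.add hg)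
  have h2 := hasSum_hart_sq (f := fun x => f x - g x) (hf.sub hg)
  have hfi := hf.integrable (q := 2) (by norm_num)
  have hgi := hg.integrable (q := 2) (by norm_num)
  have h3 := (h1.sub h2).mul_left (1 / 4)
  have i1 : Integrable (fun x => (f x + g x) ^ 2) cauchyProb := (hf.add hg).integrable_sq
  have i2 : Integrable (fun x => (f x - g x) ^ 2) cauchyProb := (hf.sub hg).integrable_sq
  rw [← integral_sub i1 i2, ← integral_const_mul] at h3
  have e1 : ∀ n, hart f n * hart g n = 1 / 4 * (hart (fun x => f x + g x) n ^ 2 -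
      hart (fun x => f x - g x) n ^ 2) := fun n => by
    rw [hart_add hfi hgi, hart_sub hfi hgi]; ring
  have e2 : ∀ x, f x * g x = 1 / 4 * ((f x + g x) ^ 2 - (f x - g x) ^ 2) := fun x => by ring
  simp only [e1, e2]
  exact h3

lemma ae_eq_of_hart_eq {f g : ℝ → ℝ} (hf : MemLp f 2 cauchyProb) (hg : MemLp g 2 cauchyProb)
    (h : ∀ n, hart f n = hart g n) : f =ᵐ[volume] g := by
  have hfi := hf.integrable (q := 2) (by norm_num)
  have hgi := hg.integrable (q := 2) (by norm_num)
  have h2 := hasSum_hart_sq (f := fun x => f x - g x) (hf.sub hg)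
  have h0 : (fun n => hart (fun x => f x - g x) n ^ 2) = fun _ => 0 := by
    ext n; rw [hart_sub hfi hgi, h, sub_self]; simp
  rw [h0] at h2
  have h3 := h2.unique hasSum_zero
  have i2 : Integrable (fun x => (f x - g x) ^ 2) cauchyProb := (hf.sub hg).integrable_sq
  rw [integral_eq_zero_iff_of_nonneg (fun _ => sq_nonneg _) i2] at h3
  refine absolutelyContinuous_cauchyProb.ae_eq (h3.mono fun x hx => ?_)
  have : (f x - g x) ^ 2 = 0 := hx
  exact sub_eq_zero.1 (pow_eq_zero_iff two_ne_zero |>.1 this)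

/-! ### Orthonormality and recursion of the Hartley functions -/

lemma integral_fourier_toAddCircle (n : ℤ) :
    ∫ x, (fourier n (toAddCircle x) : ℂ) ∂cauchyProb = if n = 0 then 1 else 0 := by
  rw [measurePreserving_toAddCircle.integral_comp measurableEmbedding_toAddCircle]
  have h := congrFun (fourierCoeff_fourier (T := 1) n) 0
  unfold fourierCoeff at h
  simp only [neg_zero, fourier_zero, one_smul] at h
  rw [h, Pi.single_apply]
  simp only [eq_comm]

lemma integrable_fourier_toAddCircle (n : ℤ) :
    Integrable (fun x => (fourier n (toAddCircle x) : ℂ)) cauchyProb := by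
  refine Integrable.of_bound ?_ 1 (Filter.Eventually.of_forall fun x => ?_)
  · exact ((ContinuousMap.continuous _).measurable.comp
        measurePreserving_toAddCircle.measurable).aestronglyMeasurable
  · rw [fourier_apply, Circle.norm_coe]

lemma integral_cos_arctan (n : ℤ) :
    ∫ x, Real.cos (2 * n * Real.arctan x) ∂cauchyProb = if n = 0 then 1 else 0 := by
  have h := Complex.reCLM.integral_comp_comm (integrable_fourier_toAddCircle n)
  rw [integral_fourier_toAddCircle] at h
  simp only [fourier_toAddCircle, Complex.reCLM_apply, Complex.exp_ofReal_mul_I_re] at h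
  rw [h]
  split_ifs <;> simp

lemma integral_sin_arctan (n : ℤ) :
    ∫ x, Real.sin (2 * n * Real.arctan x) ∂cauchyProb = 0 := by
  have h := Complex.imCLM.integral_comp_comm (integrable_fourier_toAddCircle n)
  rw [integral_fourier_toAddCircle] at h
  simp only [fourier_toAddCircle, Complex.imCLM_apply, Complex.exp_ofReal_mul_I_im] at h
  rw [h]
  split_ifs <;> simp

lemma hart_cas (k n : ℤ) : hart (cas k) n = if k = n then 1 else 0 := by
  unfold hart
  have h : ∀ x, cas k x * cas n x = Real.cos (2 * ((k - n : ℤ) : ℝ) * Real.arctan x)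
      + Real.sin (2 * ((k + n : ℤ) : ℝ) * Real.arctan x) := by
    intro x
    unfold cas
    push_cast
    rw [show 2 * ((k : ℝ) - n) * Real.arctan x = 2 * k * Real.arctan x - 2 * n * Real.arctan x by ring,
      show 2 * ((k : ℝ) + n) * Real.arctan x = 2 * k * Real.arctan x + 2 * n * Real.arctan x by ring,
      Real.cos_sub, Real.sin_add]
    ring
  simp only [h]
  rw [integral_add, integral_cos_arctan, integral_sin_arctan, add_zero]
  · simp only [sub_eq_zero]
  · refine Integrable.of_bound (by fun_prop) 1 (Filter.Eventually.of_forall fun x => ?_)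
    exact Real.abs_cos_le_one _
  · refine Integrable.of_bound (by fun_prop) 1 (Filter.Eventually.of_forall fun x => ?_)
    exact Real.abs_sin_le_one _

lemma weight_eq (x : ℝ) : 2 / (1 + x ^ 2) = 1 + Real.cos (2 * Real.arctan x) := by
  rw [Real.cos_two_mul, Real.cos_sq_arctan]
  ring

lemma weight_mul_cas (n : ℤ) (x : ℝ) : 2 / (1 + x ^ 2) * cas n x
    = cas n x + 1 / 2 * cas (n - 1) x + 1 / 2 * cas (n + 1) x := by
  rw [weight_eq]
  unfold cas
  push_cast
  rw [show 2 * ((n : ℝ) - 1) * Real.arctan x = 2 * n * Real.arctan x - 2 * Real.arctan x by ring,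
    show 2 * ((n : ℝ) + 1) * Real.arctan x = 2 * n * Real.arctan x + 2 * Real.arctan x by ring,
    Real.cos_sub, Real.cos_add, Real.sin_sub, Real.sin_add]
  ring

lemma abs_weight_le (x : ℝ) : |2 / (1 + x ^ 2)| ≤ 2 := by
  rw [abs_of_nonneg (by positivity), div_le_iff₀ (by positivity)]
  nlinarith [sq_nonneg x]

/-- The weight is `1 + cos θ`, so multiplication by it couples only neighbouring frequencies; this
produces the Jacobi structure of the eigenvalue equation. -/
lemma hart_weight_mul {f : ℝ → ℝ} (hf : Integrable f cauchyProb) (n : ℤ) :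
    hart (fun x => 2 / (1 + x ^ 2) * f x) n
      = hart f n + 1 / 2 * hart f (n - 1) + 1 / 2 * hart f (n + 1) := by
  unfold hart
  have h : ∀ x, 2 / (1 + x ^ 2) * f x * cas n x = f x * cas n x + 1 / 2 * (f x * cas (n - 1) x)
      + 1 / 2 * (f x * cas (n + 1) x) := by
    intro x
    rw [mul_right_comm, weight_mul_cas]; ring
  simp only [h]
  rw [integral_add, integral_add, integral_const_mul, integral_const_mul]
  · exact integrable_mul_cas hf _
  · exact (integrable_mul_cas hf _).const_mul _
  · exact (integrable_mul_cas hf _).add ((integrable_mul_cas hf _).const_mul _)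
  · exact (integrable_mul_cas hf _).const_mul _

lemma memLp_weight_mul {f : ℝ → ℝ} {p : ENNReal} {μ : Measure ℝ} (hf : MemLp f p μ) :
    MemLp (fun x => 2 / (1 + x ^ 2) * f x) p μ := by
  refine hf.of_le_mul (c := 2) (AEStronglyMeasurable.mul
    (Measurable.aestronglyMeasurable (by fun_prop)) hf.1)
    (Filter.Eventually.of_forall fun x => ?_)
  rw [norm_mul]
  exact mul_le_mul_of_nonneg_right (abs_weight_le x) (norm_nonneg _)

/-! ### The energy space in terms of Hartley coefficients -/

lemma lintegral_gagliardo {f : ℝ → ℝ} (hf : MemLp f 2 cauchyProb) :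
    ∫⁻ p : ℝ × ℝ, ENNReal.ofReal ((f p.1 - f p.2) ^ 2 / (p.1 - p.2) ^ 2) =
      ∑' n : ℤ, ENNReal.ofReal (4 * Real.pi ^ 2 * (|(n : ℝ)| * hart f n ^ 2)) := by
  have h1 := lintegral_gagliardo_circle (memLp_comp_ofAddCircle hf)
  have hmp := measurePreserving_toAddCircle.prod measurePreserving_toAddCircle
  rw [← hmp.lintegral_comp_emb
    (measurableEmbedding_toAddCircle.prodMap measurableEmbedding_toAddCircle)] at h1
  simp only [Prod.map_fst, Prod.map_snd, ofAddCircle_toAddCircle] at h1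
  rw [lintegral_gagliardo_line (hf.1.mono_ac absolutelyContinuous_cauchyProb).aemeasurable, h1]
  have h2 := tsum_even_weight_fourierCoeffLine (hf.integrable (q := 2) (by norm_num))
    (w := fun n => |(n : ℝ)|) (fun _ => abs_nonneg _) (fun _ => by simp)
  unfold fourierCoeffLine at h2
  rw [h2, ← ENNReal.tsum_mul_left]
  congr 1
  ext n
  rw [← ENNReal.ofReal_mul (by positivity)]

lemma MemHdotHalf.integrable {f : ℝ → ℝ} (hf : MemHdotHalf f) : Integrable f cauchyProb :=
  integrable_cauchyProb_iff.2 hf.1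

lemma MemHdotHalf.aestronglyMeasurable {f : ℝ → ℝ} (hf : MemHdotHalf f) :
    AEStronglyMeasurable f volume :=
  hf.integrable.1.mono_ac absolutelyContinuous_cauchyProb

/-- Chords have length at most `2`, so the energy dominates `∬ (f x - f y)²` for the Cauchy
probability. By Fubini `f - f y` is square integrable for some `y`, and constants are square
integrable for a probability measure. -/
lemma MemHdotHalf.memLp {f : ℝ → ℝ} (hf : MemHdotHalf f) : MemLp f 2 cauchyProb := by
  have hfm := hf.integrable.1.aemeasurable
  have h1 := lintegral_gagliardo_line hf.aestronglyMeasurable.aemeasurable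
  have hfin : ∫⁻ p : ℝ × ℝ, ENNReal.ofReal ((f p.1 - f p.2) ^ 2 / (p.1 - p.2) ^ 2) < ⊤ :=
    ((hasFiniteIntegral_iff_ofReal (Filter.Eventually.of_forall fun p => by positivity)).1 hf.2.2)
  rw [h1] at hfin
  have hpos : ENNReal.ofReal (4 * Real.pi ^ 2) ≠ 0 := by
    have := Real.pi_pos
    simp only [ne_eq, ENNReal.ofReal_eq_zero, not_le]; positivity
  have hfin2 := ENNReal.lt_top_of_mul_ne_top_right hfin.ne hpos
  have hle : ∫⁻ p : ℝ × ℝ, ENNReal.ofReal ((f p.1 - f p.2) ^ 2) ∂(cauchyProb.prod cauchyProb) < ⊤ := by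
    refine lt_of_le_of_lt (b := ENNReal.ofReal 4 * _) ?_
      (ENNReal.mul_lt_top ENNReal.ofReal_lt_top hfin2)
    rw [← lintegral_const_mul' _ _ ENNReal.ofReal_ne_top]
    refine lintegral_mono fun p => ?_
    rw [← ENNReal.ofReal_mul (by norm_num)]
    refine ENNReal.ofReal_le_ofReal ?_
    rcases eq_or_ne p.1 p.2 with h | h
    · simp [h]
    · have hn : ‖(fourier 1 (toAddCircle p.1) : ℂ) - fourier 1 (toAddCircle p.2)‖ ≤ 2 := by
        refine (norm_sub_le _ _).trans ?_
        rw [fourier_apply, fourier_apply, Circle.norm_coe, Circle.norm_coe]; norm_num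
      have hn2 : ‖(fourier 1 (toAddCircle p.1) : ℂ) - fourier 1 (toAddCircle p.2)‖ ^ 2 ≤ 4 := by
        nlinarith [norm_nonneg ((fourier 1 (toAddCircle p.1) : ℂ) - fourier 1 (toAddCircle p.2))]
      have hp : 0 < ‖(fourier 1 (toAddCircle p.1) : ℂ) - fourier 1 (toAddCircle p.2)‖ ^ 2 := by
        rw [norm_fourier_one_sub_sq]
        have := sub_ne_zero.2 h
        positivity
      rw [mul_div_assoc', le_div_iff₀ hp]
      nlinarith [sq_nonneg (f p.1 - f p.2)]
  have hf1 : AEMeasurable (fun p : ℝ × ℝ => f p.1) (cauchyProb.prod cauchyProb) :=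
    hfm.comp_quasiMeasurePreserving Measure.quasiMeasurePreserving_fst
  have hf2 : AEMeasurable (fun p : ℝ × ℝ => f p.2) (cauchyProb.prod cauchyProb) :=
    hfm.comp_quasiMeasurePreserving Measure.quasiMeasurePreserving_snd
  have hgm : AEMeasurable (fun p : ℝ × ℝ => ENNReal.ofReal ((f p.1 - f p.2) ^ 2))
    (cauchyProb.prod cauchyProb) := by fun_prop
  rw [lintegral_prod_symm _ hgm] at hle
  have hae := ae_lt_top' hgm.prod_swap.lintegral_prod_right' hle.ne
  obtain ⟨y, hy⟩ := hae.exists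
  have hy' : ∫⁻ x, ENNReal.ofReal ((f x - f y) ^ 2) ∂cauchyProb < ⊤ := hy
  have h2 : MemLp (fun x => f x - f y) 2 cauchyProb := by
    rw [memLp_two_iff_integrable_sq (by fun_prop)]
    exact ⟨by fun_prop, (hasFiniteIntegral_iff_ofReal
      (Filter.Eventually.of_forall fun x => sq_nonneg _)).2 hy'⟩
  have h3 := h2.add (memLp_const (f y))
  refine (memLp_congr_ae (Filter.Eventually.of_forall fun x => ?_)).1 h3
  simp

lemma memHdotHalf_of_summable {f : ℝ → ℝ} (hf : MemLp f 2 cauchyProb)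
    (hs : Summable fun n : ℤ => |(n : ℝ)| * hart f n ^ 2) : MemHdotHalf f := by
  refine ⟨integrable_cauchyProb_iff.1 (hf.integrable (by norm_num)), ?_, ?_⟩
  · have hm : AEMeasurable f volume := (hf.1.mono_ac absolutelyContinuous_cauchyProb).aemeasurable
    have hf1 : AEMeasurable (fun p : ℝ × ℝ => f p.1) :=
      hm.comp_quasiMeasurePreserving Measure.quasiMeasurePreserving_fst
    have hf2 : AEMeasurable (fun p : ℝ × ℝ => f p.2) :=
      hm.comp_quasiMeasurePreserving Measure.quasiMeasurePreserving_snd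
    exact AEMeasurable.aestronglyMeasurable (by fun_prop)
  · rw [hasFiniteIntegral_iff_ofReal (Filter.Eventually.of_forall fun p => by positivity),
      lintegral_gagliardo hf]
    rw [← ENNReal.ofReal_tsum_of_nonneg (fun n => by positivity) (hs.mul_left _)]
    exact ENNReal.ofReal_lt_top

lemma memHdotHalf_cas (n : ℤ) : MemHdotHalf (cas n) := by
  refine memHdotHalf_of_summable (memLp_cas n) (summable_of_ne_finset_zero (s := {n}) ?_)
  intro k hk
  rw [hart_cas, if_neg (by simpa using (Ne.symm (by simpa using hk)))]
  simp

/-- The difference quotient, whose square integral is the Gagliardo energy. -/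
def diffQuot (f : ℝ → ℝ) (p : ℝ × ℝ) : ℝ := (f p.1 - f p.2) / (p.1 - p.2)

lemma MemHdotHalf.memLp_diffQuot {f : ℝ → ℝ} (hf : MemHdotHalf f) : MemLp (diffQuot f) 2 := by
  have hm := hf.aestronglyMeasurable.aemeasurable
  have hf1 : AEMeasurable (fun p : ℝ × ℝ => f p.1) :=
    hm.comp_quasiMeasurePreserving Measure.quasiMeasurePreserving_fst
  have hf2 : AEMeasurable (fun p : ℝ × ℝ => f p.2) :=
    hm.comp_quasiMeasurePreserving Measure.quasiMeasurePreserving_snd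
  rw [memLp_two_iff_integrable_sq]
  · simpa only [diffQuot, div_pow] using hf.2
  · exact AEMeasurable.aestronglyMeasurable (by unfold diffQuot; fun_prop)

lemma halfLapForm_eq (f g : ℝ → ℝ) :
    halfLapForm f g = 1 / (2 * Real.pi) * ∫ p, diffQuot f p * diffQuot g p := by
  unfold halfLapForm diffQuot
  congr 2
  ext p
  rw [div_mul_div_comm, sq]

lemma memHdotHalf_of_diffQuot {f : ℝ → ℝ} (hf : Integrable f cauchyProb)
    (h : MemLp (diffQuot f) 2) : MemHdotHalf f :=
  ⟨integrable_cauchyProb_iff.1 hf, by simpa only [diffQuot, div_pow] using h.integrable_sq⟩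

lemma diffQuot_add (f g : ℝ → ℝ) :
    diffQuot (fun x => f x + g x) = fun p => diffQuot f p + diffQuot g p := by
  ext p; simp only [diffQuot]; ring

lemma diffQuot_const_mul (c : ℝ) (f : ℝ → ℝ) :
    diffQuot (fun x => c * f x) = fun p => c * diffQuot f p := by
  ext p; simp only [diffQuot]; ring

lemma MemHdotHalf.add {f g : ℝ → ℝ} (hf : MemHdotHalf f) (hg : MemHdotHalf g) :
    MemHdotHalf fun x => f x + g x :=
  memHdotHalf_of_diffQuot (hf.integrable.add hg.integrable) (by
    rw [diffQuot_add]; exact hf.memLp_diffQuot.add hg.memLp_diffQuot)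

lemma MemHdotHalf.const_mul {f : ℝ → ℝ} (hf : MemHdotHalf f) (c : ℝ) :
    MemHdotHalf fun x => c * f x :=
  memHdotHalf_of_diffQuot (hf.integrable.const_mul c) (by
    rw [diffQuot_const_mul]; exact hf.memLp_diffQuot.const_mul c)

lemma MemHdotHalf.sub {f g : ℝ → ℝ} (hf : MemHdotHalf f) (hg : MemHdotHalf g) :
    MemHdotHalf fun x => f x - g x := by
  have h := hf.add (hg.const_mul (-1))
  simpa only [neg_mul, one_mul, ← sub_eq_add_neg] using h

lemma memHdotHalf_zero : MemHdotHalf fun _ => 0 := by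
  simpa using (memHdotHalf_cas 0).const_mul 0

lemma MemHdotHalf.sum {ι : Type*} {s : Finset ι} {f : ι → ℝ → ℝ}
    (hf : ∀ i ∈ s, MemHdotHalf (f i)) : MemHdotHalf fun x => ∑ i ∈ s, f i x := by
  classical
  induction s using Finset.induction_on with
  | empty => simpa using memHdotHalf_zero
  | insert a s ha ih =>
    simp only [Finset.sum_insert ha]
    exact (hf a (Finset.mem_insert_self a s)).add
      (ih fun i hi => hf i (Finset.mem_insert_of_mem hi))

lemma hasSum_hdotNormSq {f : ℝ → ℝ} (hf : MemHdotHalf f) :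
    HasSum (fun n : ℤ => 2 * Real.pi * (|(n : ℝ)| * hart f n ^ 2)) (hdotNormSq f) := by
  have hpi := Real.pi_pos
  have h := hasSum_of_lintegral_eq_tsum (fun p => by positivity)
    (fun n : ℤ => by positivity) hf.2 (lintegral_gagliardo hf.memLp)
  have h2 := h.mul_left (1 / (2 * Real.pi))
  have e1 : hdotNormSq f = 1 / (2 * Real.pi) *
      ∫ p : ℝ × ℝ, (f p.1 - f p.2) ^ 2 / (p.1 - p.2) ^ 2 := by
    unfold hdotNormSq halfLapForm
    simp only [← sq]
  rw [e1]
  have e2 : ∀ n : ℤ, 2 * Real.pi * (|(n : ℝ)| * hart f n ^ 2) =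
      1 / (2 * Real.pi) * (4 * Real.pi ^ 2 * (|(n : ℝ)| * hart f n ^ 2)) := by
    intro n; field_simp; ring
  simp only [e2]
  exact h2

/-- The half-Laplacian is diagonal in the Hartley basis. -/
lemma hasSum_halfLapForm {f g : ℝ → ℝ} (hf : MemHdotHalf f) (hg : MemHdotHalf g) :
    HasSum (fun n : ℤ => 2 * Real.pi * (|(n : ℝ)| * (hart f n * hart g n))) (halfLapForm f g) := by
  have h1 := hasSum_hdotNormSq (hf.add hg)
  have h2 := hasSum_hdotNormSq (hf.sub hg)
  have h3 := (h1.sub h2).mul_left (1 / 4)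
  have dsub : diffQuot (fun x => f x - g x) = fun p => diffQuot f p - diffQuot g p := by
    ext p; simp only [diffQuot]; ring
  have e1 : ∀ n : ℤ, 2 * Real.pi * (|(n : ℝ)| * (hart f n * hart g n)) =
      1 / 4 * (2 * Real.pi * (|(n : ℝ)| * hart (fun x => f x + g x) n ^ 2) -
        2 * Real.pi * (|(n : ℝ)| * hart (fun x => f x - g x) n ^ 2)) := by
    intro n
    rw [hart_add hf.integrable hg.integrable, hart_sub hf.integrable hg.integrable]; ring
  have e2 : halfLapForm f g = 1 / 4 * (hdotNormSq (fun x => f x + g x) -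
      hdotNormSq (fun x => f x - g x)) := by
    unfold hdotNormSq
    rw [halfLapForm_eq, halfLapForm_eq, halfLapForm_eq, ← mul_sub, diffQuot_add, dsub,
      ← integral_sub, mul_left_comm, ← integral_const_mul (1 / 4 : ℝ)]
    · congr 2; ext p; ring
    · exact (hf.memLp_diffQuot.add hg.memLp_diffQuot).integrable_mul
        (hf.memLp_diffQuot.add hg.memLp_diffQuot)
    · exact (hf.memLp_diffQuot.sub hg.memLp_diffQuot).integrable_mul
        (hf.memLp_diffQuot.sub hg.memLp_diffQuot)
  simp only [e1, e2]
  exact h3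

/-! ### The form of `L₊` in Hartley coefficients -/

lemma integral_mul_div_one_add_sq (f : ℝ → ℝ) (c : ℝ) :
    ∫ x, c / (1 + x ^ 2) * f x = c * Real.pi * ∫ x, f x ∂cauchyProb := by
  rw [integral_cauchyProb, mul_assoc, mul_inv_cancel_left₀ Real.pi_ne_zero, ← integral_const_mul]
  congr 1
  ext x
  ring

lemma integrable_div_one_add_sq_mul {f : ℝ → ℝ} (hf : Integrable f cauchyProb) (c : ℝ) :
    Integrable fun x => c / (1 + x ^ 2) * f x := by
  have h := (integrable_cauchyProb_iff.1 hf).const_mul c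
  refine h.congr (Filter.Eventually.of_forall fun x => ?_)
  simp only
  ring

/-- The potential times `dx` is `2mπ` times the Cauchy measure, so Parseval turns it into the
constant `m` at every frequency. -/
lemma hasSum_LplusForm (m : ℕ) {f g : ℝ → ℝ} (hf : MemHdotHalf f) (hg : MemHdotHalf g) :
    HasSum (fun n : ℤ => 2 * Real.pi * ((|(n : ℝ)| - m) * (hart f n * hart g n)))
      (LplusForm m f g) := by
  unfold LplusForm
  rw [integral_mul_div_one_add_sq]
  have h := (hasSum_halfLapForm hf hg).sub
    ((hasSum_hart_mul hf.memLp hg.memLp).mul_left (2 * (m : ℝ) * Real.pi))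
  have e : ∀ n : ℤ, 2 * Real.pi * ((|(n : ℝ)| - m) * (hart f n * hart g n)) =
      2 * Real.pi * (|(n : ℝ)| * (hart f n * hart g n)) -
        2 * (m : ℝ) * Real.pi * (hart f n * hart g n) := fun n => by ring
  simp only [e]
  exact h

lemma LplusForm_comm (m : ℕ) (f g : ℝ → ℝ) : LplusForm m f g = LplusForm m g f := by
  unfold LplusForm halfLapForm
  congr 1
  · exact congrArg _ (integral_congr_ae (.of_forall fun p => by simp only; ring))
  · exact integral_congr_ae (.of_forall fun x => by simp only; ring)

/-! ### The operator `R` -/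

lemma norm_sum_exp_sq {ι : Type*} (s : Finset ι) (α : ι → ℝ) :
    ‖∑ j ∈ s, Complex.exp ((α j : ℂ) * Complex.I)‖ ^ 2 =
      ∑ j ∈ s, ∑ l ∈ s, Real.cos (α j - α l) := by
  rw [← Complex.normSq_eq_norm_sq, Complex.normSq_apply, Complex.re_sum, Complex.im_sum]
  simp only [Complex.exp_ofReal_mul_I_re, Complex.exp_ofReal_mul_I_im]
  rw [Finset.sum_mul_sum, Finset.sum_mul_sum, ← Finset.sum_add_distrib]
  refine Finset.sum_congr rfl fun j _ => ?_
  rw [← Finset.sum_add_distrib]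
  refine Finset.sum_congr rfl fun l _ => ?_
  rw [Real.cos_sub]

lemma Qmap_eq (m : ℕ) (x : ℝ) :
    Qmap m x = (-Complex.I) ^ m * (fourier 1 (toAddCircle x) : ℂ) ^ m := by
  have hne : (1 : ℂ) - x * Complex.I ≠ 0 := by
    intro h; have := congrArg Complex.re h; simp at this
  have hne2 : (x : ℂ) + Complex.I ≠ 0 := by
    intro h; have := congrArg Complex.im h; simp at this
  unfold Qmap
  rw [fourier_one_toAddCircle, ← mul_pow]
  congr 1
  rw [mul_div_assoc', mul_div_assoc', div_eq_div_iff hne2 hne]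
  ring_nf
  simp only [Complex.I_sq, show Complex.I ^ 3 = -Complex.I by
    rw [pow_succ, Complex.I_sq]; ring]
  ring

/-- Factor `z ^ m - w ^ m` by `z - w` and expand the squared modulus of the cofactor. The outcome
separates the variables into products `cas k x * cas k y`, which makes the positivity of `R`
visible. -/
lemma norm_Qmap_sub_sq (m : ℕ) (x y : ℝ) : ‖Qmap m x - Qmap m y‖ ^ 2 =
    4 * (x - y) ^ 2 / ((1 + x ^ 2) * (1 + y ^ 2)) *
      ∑ j ∈ Finset.range m, ∑ l ∈ Finset.range m,
        cas ((j : ℤ) - l) x * cas ((j : ℤ) - l) y := by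
  rw [Qmap_eq, Qmap_eq, ← mul_sub, ← geom_sum₂_mul, norm_mul, norm_pow, norm_neg, Complex.norm_I,
    one_pow, one_mul, norm_mul, mul_pow, norm_fourier_one_sub_sq, mul_comm]
  congr 1
  set a := Real.arctan x with ha
  set b := Real.arctan y with hb
  have h1 : ∀ j ∈ Finset.range m, (fourier 1 (toAddCircle x) : ℂ) ^ j *
      (fourier 1 (toAddCircle y) : ℂ) ^ (m - 1 - j) =
      Complex.exp (((2 * j * a + 2 * ((m - 1 - j : ℕ) : ℝ) * b : ℝ) : ℂ) * Complex.I) := by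
    intro j _
    rw [← fourier_natCast, ← fourier_natCast, fourier_toAddCircle, fourier_toAddCircle,
      ← Complex.exp_add, ← ha, ← hb]
    congr 1
    push_cast
    ring
  rw [Finset.sum_congr rfl h1, norm_sum_exp_sq]
  -- The expansion yields only the cosines of differences of angles; `cas k x * cas k y` also
  -- contains the sine of the sum. These sines are odd under `j ↔ l`, so they can be added for free.
  have h2 : ∑ j ∈ Finset.range m, ∑ l ∈ Finset.range m,
      Real.sin (2 * ((j : ℝ) - l) * (a + b)) = 0 := by
    have h3 : ∑ j ∈ Finset.range m, ∑ l ∈ Finset.range m, Real.sin (2 * ((j : ℝ) - l) * (a + b))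
        = -∑ j ∈ Finset.range m, ∑ l ∈ Finset.range m,
          Real.sin (2 * ((j : ℝ) - l) * (a + b)) := by
      conv_lhs => rw [Finset.sum_comm]
      rw [← Finset.sum_neg_distrib]
      refine Finset.sum_congr rfl fun j _ => ?_
      rw [← Finset.sum_neg_distrib]
      refine Finset.sum_congr rfl fun l _ => ?_
      rw [← Real.sin_neg]
      congr 1
      ring
    linarith
  rw [← add_zero (∑ j ∈ Finset.range m, ∑ l ∈ Finset.range m, Real.cos _), ← h2,
    ← Finset.sum_add_distrib]
  refine Finset.sum_congr rfl fun j hj => ?_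
  rw [← Finset.sum_add_distrib]
  refine Finset.sum_congr rfl fun l hl => ?_
  have hj' := Finset.mem_range.1 hj
  have hl' := Finset.mem_range.1 hl
  have ej : ((m - 1 - j : ℕ) : ℝ) = m - 1 - j := by
    rw [Nat.cast_sub (by omega), Nat.cast_sub (by omega)]; simp
  have el : ((m - 1 - l : ℕ) : ℝ) = m - 1 - l := by
    rw [Nat.cast_sub (by omega), Nat.cast_sub (by omega)]; simp
  unfold cas
  push_cast
  rw [ej, el, ← ha, ← hb, show 2 * (j : ℝ) * a + 2 * ((m : ℝ) - 1 - j) * b -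
      (2 * l * a + 2 * (m - 1 - l) * b) = 2 * ((j : ℝ) - l) * a - 2 * ((j : ℝ) - l) * b by ring,
    mul_add, Real.cos_sub, Real.sin_add]
  ring

lemma Rop_integrand_ae_eq (m : ℕ) (f : ℝ → ℝ) (x : ℝ) :
    (fun y => 4 / (1 + x ^ 2) / (1 + y ^ 2) * (∑ j ∈ Finset.range m, ∑ l ∈ Finset.range m,
        cas ((j : ℤ) - l) x * (f y * cas ((j : ℤ) - l) y))) =ᵐ[volume]
    fun y => ‖Qmap m x - Qmap m y‖ ^ 2 / (x - y) ^ 2 * f y := by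
  have hne : ∀ᵐ y : ℝ, y ≠ x := by rw [ae_iff]; simp
  filter_upwards [hne] with y hy
  have h := sub_ne_zero.2 hy.symm
  have e : ∑ j ∈ Finset.range m, ∑ l ∈ Finset.range m,
        cas ((j : ℤ) - l) x * (f y * cas ((j : ℤ) - l) y) = (∑ j ∈ Finset.range m,
        ∑ l ∈ Finset.range m, cas ((j : ℤ) - l) x * cas ((j : ℤ) - l) y) * f y := by
    simp only [Finset.sum_mul]
    refine Finset.sum_congr rfl fun j _ => Finset.sum_congr rfl fun l _ => ?_
    ring
  have h1 := one_add_sq_pos x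
  have h2 := one_add_sq_pos y
  rw [norm_Qmap_sub_sq, e]
  field_simp

lemma integrable_Rop_integrand (m : ℕ) {f : ℝ → ℝ} (hf : Integrable f cauchyProb) (x : ℝ) :
    Integrable fun y => ‖Qmap m x - Qmap m y‖ ^ 2 / (x - y) ^ 2 * f y := by
  refine Integrable.congr ?_ (Rop_integrand_ae_eq m f x)
  refine integrable_div_one_add_sq_mul ?_ _
  exact integrable_finsetSum _ fun j _ => integrable_finsetSum _ fun l _ =>
    (integrable_mul_cas hf _).const_mul _

lemma Rop_eq (m : ℕ) {f : ℝ → ℝ} (hf : Integrable f cauchyProb) (x : ℝ) :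
    Rop m f x = 2 / (1 + x ^ 2) * ∑ j ∈ Finset.range m, ∑ l ∈ Finset.range m,
      hart f ((j : ℤ) - l) * cas ((j : ℤ) - l) x := by
  unfold Rop
  rw [← integral_congr_ae (Rop_integrand_ae_eq m f x), integral_mul_div_one_add_sq,
    integral_finsetSum _ fun j _ => integrable_finsetSum _ fun l _ =>
      (integrable_mul_cas hf _).const_mul _]
  have h : ∀ j ∈ Finset.range m, ∫ y, ∑ l ∈ Finset.range m,
      cas ((j : ℤ) - l) x * (f y * cas ((j : ℤ) - l) y) ∂cauchyProb
      = ∑ l ∈ Finset.range m, hart f ((j : ℤ) - l) * cas ((j : ℤ) - l) x := by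
    intro j _
    rw [integral_finsetSum _ fun l _ => (integrable_mul_cas hf _).const_mul _]
    refine Finset.sum_congr rfl fun l _ => ?_
    rw [integral_const_mul, mul_comm]
    rfl
  rw [Finset.sum_congr rfl h]
  have := Real.pi_ne_zero
  have := (one_add_sq_pos x).ne'
  field_simp
  ring

lemma mul_Rop_eq (m : ℕ) {f : ℝ → ℝ} (hf : Integrable f cauchyProb) (x : ℝ) :
    f x * Rop m f x = 2 / (1 + x ^ 2) * ∑ j ∈ Finset.range m, ∑ l ∈ Finset.range m,
      hart f ((j : ℤ) - l) * (f x * cas ((j : ℤ) - l) x) := by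
  rw [Rop_eq m hf, mul_left_comm]
  congr 1
  simp only [Finset.mul_sum]
  refine Finset.sum_congr rfl fun j _ => Finset.sum_congr rfl fun l _ => ?_
  ring

lemma integrable_mul_Rop (m : ℕ) {f : ℝ → ℝ} (hf : Integrable f cauchyProb) :
    Integrable fun x => f x * Rop m f x := by
  simp only [mul_Rop_eq m hf]
  exact integrable_div_one_add_sq_mul (integrable_finsetSum _ fun j _ =>
    integrable_finsetSum _ fun l _ => (integrable_mul_cas hf _).const_mul _) _

/-- The integral is `2π` times the sum over `j, l < m` of the squares of `hart f (j - l)`. -/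
lemma integral_mul_Rop_nonneg (m : ℕ) {f : ℝ → ℝ} (hf : Integrable f cauchyProb) :
    0 ≤ ∫ x, f x * Rop m f x := by
  simp only [mul_Rop_eq m hf]
  rw [integral_mul_div_one_add_sq, integral_finsetSum _ fun j _ => integrable_finsetSum _ fun l _ =>
      (integrable_mul_cas hf _).const_mul _]
  refine mul_nonneg (by have := Real.pi_pos; positivity) (Finset.sum_nonneg fun j _ => ?_)
  rw [integral_finsetSum _ fun l _ => (integrable_mul_cas hf _).const_mul _]
  refine Finset.sum_nonneg fun l _ => ?_
  rw [integral_const_mul]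
  exact mul_self_nonneg _

lemma LminusForm_zero (m : ℕ) : LminusForm m (fun _ => 0) (fun _ => 0) = 0 := by
  simp [LminusForm, LplusForm, halfLapForm]

lemma LplusForm_le_LminusForm (m : ℕ) {f : ℝ → ℝ} (hf : Integrable f cauchyProb) :
    LplusForm m f f ≤ LminusForm m f f := by
  unfold LminusForm
  linarith [integral_mul_Rop_nonneg m hf]

/-! ### Square integrability on the line -/

lemma memLp_two_of_sq_le {f : ℝ → ℝ} (hf : AEStronglyMeasurable f volume) (C : ℝ)
    (h : ∀ x, f x ^ 2 ≤ C / (1 + x ^ 2)) : MemLp f 2 := by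
  rw [memLp_two_iff_integrable_sq hf]
  refine (integrable_inv_one_add_sq.const_mul C).mono' (hf.pow 2)
    (Filter.Eventually.of_forall fun x => ?_)
  rw [Real.norm_eq_abs, abs_of_nonneg (sq_nonneg _), ← div_eq_mul_inv]
  exact h x

lemma memLp_div_one_add_sq_mul {f : ℝ → ℝ} (hf : AEStronglyMeasurable f volume) {C : ℝ}
    (h : ∀ x, |f x| ≤ C) (c : ℝ) : MemLp (fun x => c / (1 + x ^ 2) * f x) 2 := by
  refine memLp_two_of_sq_le (AEStronglyMeasurable.mul
    (Measurable.aestronglyMeasurable (by fun_prop)) hf) (c ^ 2 * C ^ 2) fun x => ?_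
  have h1 : f x ^ 2 ≤ C ^ 2 := sq_le_sq' (abs_le.1 (h x)).1 (abs_le.1 (h x)).2
  have h2 := one_add_sq_pos x
  rw [mul_pow, div_pow, div_mul_eq_mul_div, div_le_div_iff₀ (by positivity) h2]
  have h3 : c ^ 2 * f x ^ 2 ≤ c ^ 2 * C ^ 2 := mul_le_mul_of_nonneg_left h1 (sq_nonneg c)
  have h4 : 1 + x ^ 2 ≤ (1 + x ^ 2) ^ 2 := by nlinarith [sq_nonneg x]
  exact mul_le_mul h3 h4 h2.le (by positivity)

/-- The factor `cos (arctan x) = (1 + x²)^(-1/2)` makes neighbouring sums square integrable on the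
line, although no single `cas n` is. -/
lemma cas_add_cas_succ (n : ℤ) (x : ℝ) : cas n x + cas (n + 1) x =
    2 * Real.cos (Real.arctan x) * (Real.cos ((2 * n + 1) * Real.arctan x)
      + Real.sin ((2 * n + 1) * Real.arctan x)) := by
  unfold cas
  push_cast
  rw [show 2 * (n : ℝ) * Real.arctan x = (2 * n + 1) * Real.arctan x - Real.arctan x by ring,
    show 2 * ((n : ℝ) + 1) * Real.arctan x = (2 * n + 1) * Real.arctan x + Real.arctan x by ring,
    Real.cos_sub, Real.cos_add, Real.sin_sub, Real.sin_add]
  ring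

lemma memLp_cas_add_cas_succ (n : ℤ) : MemLp (fun x => cas n x + cas (n + 1) x) 2 := by
  refine memLp_two_of_sq_le (by fun_prop) 8 fun x => ?_
  rw [cas_add_cas_succ, mul_pow, mul_pow, Real.cos_sq_arctan, ← mul_one_div (8 : ℝ)]
  have h1 := Real.sin_sq_add_cos_sq ((2 * n + 1) * Real.arctan x)
  have h2 : 0 ≤ 1 / (1 + x ^ 2) := by positivity
  nlinarith [sq_nonneg (Real.cos ((2 * n + 1) * Real.arctan x)
    - Real.sin ((2 * n + 1) * Real.arctan x))]

lemma cas_zero (x : ℝ) : cas 0 x = 1 := by simp [cas]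

/-- Infinity corresponds to `θ = π`, where `cas n` takes the value `(-1) ^ n`. The claim propagates
from `n = 0` by the neighbouring sums. -/
lemma memLp_cas_sub_sign (n : ℤ) : MemLp (fun x => cas n x - (-1 : ℝ) ^ n) 2 := by
  induction n using Int.induction_on with
  | zero => simp [cas_zero]
  | succ n ih =>
    have h := (memLp_cas_add_cas_succ n).sub ih
    refine (memLp_congr_ae (Filter.Eventually.of_forall fun x => ?_)).1 h
    simp only [Pi.sub_apply]
    rw [zpow_add_one₀ (by norm_num)]
    ring
  | pred n ih =>
    have h := (memLp_cas_add_cas_succ (-(n : ℤ) - 1)).sub ih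
    refine (memLp_congr_ae (Filter.Eventually.of_forall fun x => ?_)).1 h
    simp only [Pi.sub_apply, sub_add_cancel]
    rw [zpow_sub_one₀ (by norm_num), inv_neg, inv_one]
    ring

/-- The zero mode `cas m - cas (-m) = 2 sin (mθ)` is square integrable. -/
lemma memLp_cas_sub_cas_neg (m : ℤ) : MemLp (fun x => cas m x - cas (-m) x) 2 := by
  have h := (memLp_cas_sub_sign m).sub (memLp_cas_sub_sign (-m))
  refine (memLp_congr_ae (Filter.Eventually.of_forall fun x => ?_)).1 h
  simp only [Pi.sub_apply]
  rw [zpow_neg, ← inv_zpow, inv_neg, inv_one]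
  ring

lemma cas_sq_add_cas_neg_sq (m : ℤ) (x : ℝ) : cas m x ^ 2 + cas (-m) x ^ 2 = 2 := by
  unfold cas
  push_cast
  rw [show 2 * -(m : ℝ) * Real.arctan x = -(2 * m * Real.arctan x) by ring, Real.cos_neg,
    Real.sin_neg]
  nlinarith [Real.sin_sq_add_cos_sq (2 * m * Real.arctan x)]

/-- The zero mode `cas m + cas (-m) = 2 cos (mθ)` is not square integrable. -/
lemma not_memLp_cas_add_cas_neg (m : ℤ) : ¬ MemLp (fun x => cas m x + cas (-m) x) 2 := by
  intro h
  -- The squares of `cas m + cas (-m)` and `cas m - cas (-m)` add up to the constant `4`, which is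
  -- not integrable on the line.
  have h1 := h.integrable_sq.add (memLp_cas_sub_cas_neg m).integrable_sq
  have h2 : Integrable (fun _ : ℝ => (4 : ℝ)) := by
    refine h1.congr (Filter.Eventually.of_forall fun x => ?_)
    simp only [Pi.add_apply]
    nlinarith [cas_sq_add_cas_neg_sq m x]
  rw [integrable_const_iff] at h2
  rcases h2 with h2 | h2
  · norm_num at h2
  · have := h2.measure_univ_lt_top
    simp at this

/-! ### Weak derivatives -/

lemma memH1_of_hasDerivAt {f f' : ℝ → ℝ} (hf : MemLp f 2) (hf' : MemLp f' 2)
    (h : ∀ x, HasDerivAt f (f' x) x) : MemH1 f := by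
  refine ⟨hf, f', hf', fun η hη hc => ?_⟩
  have h1 : MemLp η 2 := hη.continuous.memLp_of_hasCompactSupport hc
  have h2 : MemLp (deriv η) 2 :=
    (hη.continuous_deriv (by simp)).memLp_of_hasCompactSupport hc.deriv
  exact integral_mul_deriv_eq_deriv_mul_of_integrable (fun x _ => h x)
    (fun x _ => (hη.differentiable (by simp) x).hasDerivAt)
    (hf.integrable_mul h2) (hf'.integrable_mul h1) (hf.integrable_mul h1)

/-- Differentiable functions with square integrable derivative. -/
def HasL2Deriv (f : ℝ → ℝ) : Prop :=
  ∃ f' : ℝ → ℝ, MemLp f' 2 ∧ ∀ x, HasDerivAt f (f' x) x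

lemma HasL2Deriv.memH1 {f : ℝ → ℝ} (h : HasL2Deriv f) (hf : MemLp f 2) : MemH1 f := by
  obtain ⟨f', h1, h2⟩ := h
  exact memH1_of_hasDerivAt hf h1 h2

lemma HasL2Deriv.add {f g : ℝ → ℝ} (hf : HasL2Deriv f) (hg : HasL2Deriv g) :
    HasL2Deriv fun x => f x + g x := by
  obtain ⟨f', h1, h2⟩ := hf
  obtain ⟨g', h3, h4⟩ := hg
  exact ⟨fun x => f' x + g' x, h1.add h3, fun x => (h2 x).add (h4 x)⟩

lemma HasL2Deriv.const_mul {f : ℝ → ℝ} (hf : HasL2Deriv f) (c : ℝ) :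
    HasL2Deriv fun x => c * f x := by
  obtain ⟨f', h1, h2⟩ := hf
  exact ⟨fun x => c * f' x, h1.const_mul c, fun x => (h2 x).const_mul c⟩

lemma HasL2Deriv.sum {ι : Type*} {s : Finset ι} {f : ι → ℝ → ℝ}
    (hf : ∀ i ∈ s, HasL2Deriv (f i)) : HasL2Deriv fun x => ∑ i ∈ s, f i x := by
  classical
  induction s using Finset.induction_on with
  | empty => exact ⟨fun _ => 0, by simp, fun x => by simpa using hasDerivAt_const x (0 : ℝ)⟩
  | insert a s ha ih =>
    simp only [Finset.sum_insert ha]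
    exact (hf a (Finset.mem_insert_self a s)).add
      (ih fun i hi => hf i (Finset.mem_insert_of_mem hi))

lemma hasL2Deriv_cas (n : ℤ) : HasL2Deriv (cas n) := by
  refine ⟨fun x => 2 * n / (1 + x ^ 2) * cas (-n) x,
    memLp_div_one_add_sq_mul (by fun_prop) (abs_cas_le (-n)) _, fun x => ?_⟩
  have h1 := (Real.hasDerivAt_arctan x).const_mul (2 * (n : ℝ))
  have h2 := h1.cos.add h1.sin
  refine h2.congr_deriv ?_
  unfold cas
  push_cast
  rw [show 2 * -(n : ℝ) * Real.arctan x = -(2 * n * Real.arctan x) by ring, Real.cos_neg,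
    Real.sin_neg]
  ring

/-! ### Linearity of `L₊` and zero energy solutions -/

lemma MemHdotHalf.LplusForm_add_left (m : ℕ) {f g u : ℝ → ℝ} (hf : MemHdotHalf f)
    (hg : MemHdotHalf g) (hu : MemHdotHalf u) :
    LplusForm m (fun x => f x + g x) u = LplusForm m f u + LplusForm m g u := by
  refine (hasSum_LplusForm m (hf.add hg) hu).unique ?_
  convert (hasSum_LplusForm m hf hu).add (hasSum_LplusForm m hg hu) using 2 with n
  rw [hart_add hf.integrable hg.integrable]
  ring

lemma MemHdotHalf.LplusForm_const_mul_left (m : ℕ) {f u : ℝ → ℝ} (hf : MemHdotHalf f)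
    (hu : MemHdotHalf u) (c : ℝ) :
    LplusForm m (fun x => c * f x) u = c * LplusForm m f u := by
  refine (hasSum_LplusForm m (hf.const_mul c) hu).unique ?_
  have h := (hasSum_LplusForm m hf hu).mul_left c
  have e : ∀ n : ℤ, 2 * Real.pi * ((|(n : ℝ)| - m) * (hart (fun x => c * f x) n * hart u n)) =
      c * (2 * Real.pi * ((|(n : ℝ)| - m) * (hart f n * hart u n))) := fun n => by
    rw [hart_const_mul]; ring
  simp only [e]
  exact h

lemma LplusForm_cas_left (m : ℕ) (n : ℤ) {u : ℝ → ℝ} (hu : MemHdotHalf u) :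
    LplusForm m (cas n) u = 2 * Real.pi * ((|(n : ℝ)| - m) * hart u n) := by
  refine (hasSum_LplusForm m (memHdotHalf_cas n) hu).unique ?_
  convert hasSum_single (f := fun k : ℤ => 2 * Real.pi *
    ((|(k : ℝ)| - m) * (hart (cas n) k * hart u k))) n (fun k hk => ?_) using 1
  · rw [hart_cas, if_pos rfl, one_mul]
  · rw [hart_cas, if_neg (Ne.symm hk)]; ring

lemma SolvesLplus.add_const_mul {m : ℕ} {e : ℝ} {u v : ℝ → ℝ} (hu : SolvesLplus m e u)
    (hv : SolvesLplus m e v) (hu2 : MemLp u 2) (hv2 : MemLp v 2) (c : ℝ) :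
    SolvesLplus m e fun x => u x + c * v x := by
  refine ⟨hu.1.add (hv.1.const_mul c), fun η hη hη2 => ?_⟩
  rw [LplusForm_comm, hu.1.LplusForm_add_left m (hv.1.const_mul c) hη,
    hv.1.LplusForm_const_mul_left m hη, LplusForm_comm m u, LplusForm_comm m v, hu.2 η hη hη2,
    hv.2 η hη hη2]
  have h1 : Integrable fun x => η x * u x := hη2.integrable_mul hu2
  have h2 : Integrable fun x => η x * v x := hη2.integrable_mul hv2
  have h3 : ∫ x, η x * (u x + c * v x) = (∫ x, η x * u x) + c * ∫ x, η x * v x := by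
    rw [← integral_const_mul, ← integral_add h1 (h2.const_mul c)]
    congr 1; ext x; ring
  rw [h3]; ring

/-- Zero energy solutions only have the frequencies `± m`. -/
lemma SolvesLplus.ae_eq_of_zero {m : ℕ} (hm : 1 ≤ m) {u : ℝ → ℝ} (hu : SolvesLplus m 0 u) :
    u =ᵐ[volume] fun x => hart u m * cas m x + hart u (-m) * cas (-m) x := by
  -- Test functions must lie in `L²(ℝ)`, which excludes `cas n` itself but admits `cas n + cas (n +
  -- 1)`.
  have h1 : ∀ n : ℤ, (|(n : ℝ)| - m) * hart u n +
      (|((n + 1 : ℤ) : ℝ)| - m) * hart u (n + 1) = 0 := by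
    intro n
    have h := hu.2 _ ((memHdotHalf_cas n).add (memHdotHalf_cas (n + 1))) (memLp_cas_add_cas_succ n)
    rw [(memHdotHalf_cas n).LplusForm_add_left m (memHdotHalf_cas (n + 1)) hu.1,
      LplusForm_cas_left m _ hu.1, LplusForm_cas_left m _ hu.1, zero_mul, ← mul_add] at h
    exact (mul_eq_zero.1 h).resolve_left (by have := Real.pi_ne_zero; positivity)
  have h2 : ∀ n : ℤ, (|(n : ℝ)| - m) * hart u n = 0 := by
    intro n
    -- The relation between neighbours propagates zero in both directions from `n = m`, where the
    -- factor `|n| - m` vanishes.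
    induction n using Int.inductionOn' (b := (m : ℤ)) with
    | zero => simp
    | succ k _ ih => linarith [h1 k]
    | pred k _ ih =>
      have := h1 (k - 1)
      rw [sub_add_cancel] at this
      linarith
  have hc := (memHdotHalf_cas m).const_mul (hart u m)
  have hc' := (memHdotHalf_cas (-m)).const_mul (hart u (-m))
  refine ae_eq_of_hart_eq hu.1.memLp (hc.add hc').memLp fun n => ?_
  rw [hart_add hc.integrable hc'.integrable, hart_const_mul, hart_const_mul, hart_cas, hart_cas]
  by_cases h3 : (m : ℤ) = n
  · subst h3
    rw [if_pos rfl, if_neg (by omega)]; ring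
  by_cases h4 : -(m : ℤ) = n
  · subst h4
    rw [if_neg (by omega), if_pos rfl]; ring
  · rw [if_neg h3, if_neg h4]
    have h5 : |(n : ℝ)| - m ≠ 0 := by
      intro h
      have : |n| = (m : ℤ) := by exact_mod_cast sub_eq_zero.1 h
      rcases abs_eq (by positivity) |>.1 this with h | h <;> omega
    simpa [h5] using h2 n

lemma solvesLplus_zero_of_cas (m : ℕ) (c : ℝ) :
    SolvesLplus m 0 fun x => cas m x + c * cas (-m) x := by
  have h1 := memHdotHalf_cas m
  have h2 := (memHdotHalf_cas (-m)).const_mul c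
  refine ⟨h1.add h2, fun η hη _ => ?_⟩
  rw [LplusForm_comm, h1.LplusForm_add_left m h2 hη, (memHdotHalf_cas (-m)).LplusForm_const_mul_left m hη,
    LplusForm_cas_left m _ hη, LplusForm_cas_left m _ hη]
  simp

lemma cas_comb (m : ℤ) (a b x : ℝ) : a * cas m x + b * cas (-m) x =
    (a + b) / 2 * (cas m x + cas (-m) x) + (a - b) / 2 * (cas m x - cas (-m) x) := by ring

lemma add_eq_zero_of_memLp_cas_comb {m : ℤ} {a b : ℝ}
    (h : MemLp (fun x => a * cas m x + b * cas (-m) x) 2) : a + b = 0 := by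
  by_contra hab
  refine not_memLp_cas_add_cas_neg m ?_
  have h1 := (h.sub ((memLp_cas_sub_cas_neg m).const_mul ((a - b) / 2))).const_mul (2 / (a + b))
  refine (memLp_congr_ae (Filter.Eventually.of_forall fun x => ?_)).1 h1
  simp only [Pi.sub_apply]
  rw [cas_comb]
  field_simp
  ring

/-- Square integrable zero energy solutions. -/
lemma IsEigenfunction.exists_eq_of_zero {m : ℕ} (hm : 1 ≤ m) {u : ℝ → ℝ}
    (hu : IsEigenfunction m 0 u) :
    ∃ c : ℝ, c ≠ 0 ∧ u =ᵐ[volume] fun x => c * (cas m x - cas (-m) x) := by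
  have h := hu.2.2.ae_eq_of_zero hm
  have hab := add_eq_zero_of_memLp_cas_comb ((memLp_congr_ae h).1 hu.1.1)
  have h1 : u =ᵐ[volume] fun x => hart u m * (cas m x - cas (-m) x) := by
    refine h.trans (Filter.Eventually.of_forall fun x => ?_)
    simp only
    linear_combination hab * cas (-m) x
  refine ⟨hart u m, fun h0 => hu.2.1 ?_, h1⟩
  refine h1.trans (Filter.Eventually.of_forall fun x => ?_)
  simp [h0]

/-- A resonance is determined only up to a multiple of the square integrable zero mode. The
condition `a + b ≠ 0` is what makes it independent of that mode. -/
lemma IsResonance.exists_eq {m : ℕ} (hm : 1 ≤ m) {u : ℝ → ℝ} (hu : IsResonance m u) :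
    ∃ a b : ℝ, a + b ≠ 0 ∧ u =ᵐ[volume] fun x => a * cas m x + b * cas (-m) x := by
  have h := hu.1.ae_eq_of_zero hm
  refine ⟨_, _, fun hab => hu.2 ((memLp_congr_ae h).2 ?_), h⟩
  have h1 := (memLp_cas_sub_cas_neg m).const_mul (hart u m)
  refine (memLp_congr_ae (Filter.Eventually.of_forall fun x => ?_)).1 h1
  linear_combination - hab * cas (-m) x

lemma isResonance_cas (m : ℕ) : IsResonance m fun x => cas m x + cas (-m) x := by
  have h := solvesLplus_zero_of_cas m 1
  simp only [one_mul] at h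
  exact ⟨h, not_memLp_cas_add_cas_neg m⟩

lemma not_ae_zero_of_hart_ne {u : ℝ → ℝ} {n : ℤ} (h : hart u n ≠ 0) : ¬ u =ᵐ[volume] 0 := by
  intro h0
  apply h
  rw [hart_congr h0]
  simp [hart]

lemma isEigenfunction_cas {m : ℕ} (hm : 1 ≤ m) :
    IsEigenfunction m 0 fun x => cas m x - cas (-m) x := by
  have e : (fun x => cas m x - cas (-m) x) = fun x => cas m x + (-1) * cas (-m) x := by
    ext x; ring
  refine ⟨HasL2Deriv.memH1 ?_ (memLp_cas_sub_cas_neg m), ?_, ?_⟩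
  · rw [e]; exact (hasL2Deriv_cas _).add ((hasL2Deriv_cas _).const_mul _)
  · refine not_ae_zero_of_hart_ne (n := m) ?_
    rw [hart_sub (memHdotHalf_cas _).integrable (memHdotHalf_cas _).integrable, hart_cas, hart_cas,
      if_pos rfl, if_neg (by omega)]
    norm_num
  · rw [e]; exact solvesLplus_zero_of_cas m (-1)

/-! ### Hartley polynomials -/

/-- The Hartley polynomial of degree less than `m` with coefficients `b`. -/
def trigPoly (m : ℕ) (b : ℤ → ℝ) (x : ℝ) : ℝ :=
  ∑ n ∈ Finset.Ioo (-(m : ℤ)) m, b n * cas n x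

lemma memHdotHalf_trigPoly (m : ℕ) (b : ℤ → ℝ) : MemHdotHalf (trigPoly m b) :=
  MemHdotHalf.sum fun n _ => (memHdotHalf_cas n).const_mul (b n)

lemma integral_mul_trigPoly (m : ℕ) (b : ℤ → ℝ) {g : ℝ → ℝ} (hg : Integrable g cauchyProb) :
    ∫ x, g x * trigPoly m b x ∂cauchyProb = ∑ n ∈ Finset.Ioo (-(m : ℤ)) m, b n * hart g n := by
  have h : ∀ x, g x * trigPoly m b x =
      ∑ n ∈ Finset.Ioo (-(m : ℤ)) m, b n * (g x * cas n x) := fun x => by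
    rw [trigPoly, Finset.mul_sum]
    exact Finset.sum_congr rfl fun n _ => by ring
  simp only [h]
  rw [integral_finsetSum _ fun n _ => (integrable_mul_cas hg n).const_mul _]
  exact Finset.sum_congr rfl fun n _ => by rw [integral_const_mul]; rfl

lemma mem_Ioo_neg_iff {m : ℕ} {n : ℤ} : n ∈ Finset.Ioo (-(m : ℤ)) m ↔ |n| < m := by
  rw [Finset.mem_Ioo, abs_lt]

lemma hart_trigPoly (m : ℕ) {b : ℤ → ℝ} (hb : ∀ n : ℤ, (m : ℤ) ≤ |n| → b n = 0) (n : ℤ) :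
    hart (trigPoly m b) n = b n := by
  have h : hart (trigPoly m b) n = ∫ x, cas n x * trigPoly m b x ∂cauchyProb := by
    unfold hart
    simp only [mul_comm]
  rw [h, integral_mul_trigPoly m b (memHdotHalf_cas n).integrable]
  simp only [hart_cas, mul_ite, mul_one, mul_zero]
  rw [Finset.sum_ite_eq]
  split_ifs with h1
  · rfl
  · rw [hb n (not_lt.1 fun h2 => h1 (mem_Ioo_neg_iff.2 h2))]

lemma abs_trigPoly_le (m : ℕ) (b : ℤ → ℝ) (x : ℝ) :
    |trigPoly m b x| ≤ ∑ n ∈ Finset.Ioo (-(m : ℤ)) m, |b n| * 2 := by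
  refine (Finset.abs_sum_le_sum_abs _ _).trans (Finset.sum_le_sum fun n _ => ?_)
  rw [abs_mul]
  exact mul_le_mul_of_nonneg_left (abs_cas_le n x) (abs_nonneg _)

/-! ### The Jacobi operator -/

/-- Coefficients supported on `|n| < m`, rescaled by `√(m - |n|)`. -/
def scaledCoeff (m : ℕ) (c : EuclideanSpace ℝ (Finset.Ioo (-(m : ℤ)) m)) (n : ℤ) : ℝ :=
  if h : n ∈ Finset.Ioo (-(m : ℤ)) m then Real.sqrt (m - |(n : ℝ)|) * c ⟨n, h⟩ else 0

lemma scaledCoeff_of_le {m : ℕ} (c : EuclideanSpace ℝ (Finset.Ioo (-(m : ℤ)) m)) (n : ℤ)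
    (h : (m : ℤ) ≤ |n|) : scaledCoeff m c n = 0 :=
  dif_neg fun h1 => absurd (mem_Ioo_neg_iff.1 h1) (not_lt.2 h)

lemma scaledCoeff_coe {m : ℕ} (c : EuclideanSpace ℝ (Finset.Ioo (-(m : ℤ)) m))
    (p : Finset.Ioo (-(m : ℤ)) (m : ℤ)) :
    scaledCoeff m c p = Real.sqrt (m - |((p : ℤ) : ℝ)|) * c p := dif_pos p.2

lemma sub_abs_pos {m : ℕ} (p : Finset.Ioo (-(m : ℤ)) (m : ℤ)) : 0 < (m : ℝ) - |((p : ℤ) : ℝ)| := by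
  have h := mem_Ioo_neg_iff.1 p.2
  rw [sub_pos]
  exact_mod_cast h

lemma scaledCoeff_add {m : ℕ} (c d : EuclideanSpace ℝ (Finset.Ioo (-(m : ℤ)) m)) (n : ℤ) :
    scaledCoeff m (c + d) n = scaledCoeff m c n + scaledCoeff m d n := by
  unfold scaledCoeff
  split_ifs
  · simp [mul_add]
  · simp

lemma scaledCoeff_smul {m : ℕ} (r : ℝ) (c : EuclideanSpace ℝ (Finset.Ioo (-(m : ℤ)) m)) (n : ℤ) :
    scaledCoeff m (r • c) n = r * scaledCoeff m c n := by
  unfold scaledCoeff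
  split_ifs
  · simp [mul_left_comm]
  · simp

/-- The Jacobi operator `√(m - |n|) (1 + cos θ) √(m - |n|)`, whose eigenvalues are minus the
negative eigenvalues of `L₊`. -/
def jacobiOp (m : ℕ) : EuclideanSpace ℝ (Finset.Ioo (-(m : ℤ)) m) →ₗ[ℝ]
    EuclideanSpace ℝ (Finset.Ioo (-(m : ℤ)) (m : ℤ)) where
  toFun c := WithLp.toLp 2 fun p => Real.sqrt (m - |((p : ℤ) : ℝ)|) *
    (scaledCoeff m c p + 1 / 2 * scaledCoeff m c (p - 1) + 1 / 2 * scaledCoeff m c (p + 1))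
  map_add' c d := by
    ext p
    simp only [scaledCoeff_add, PiLp.add_apply]
    ring
  map_smul' r c := by
    ext p
    simp only [scaledCoeff_smul, PiLp.smul_apply, RingHom.id_apply, smul_eq_mul]
    ring

lemma jacobiOp_apply (m : ℕ) (c : EuclideanSpace ℝ (Finset.Ioo (-(m : ℤ)) m))
    (p : Finset.Ioo (-(m : ℤ)) (m : ℤ)) : jacobiOp m c p = Real.sqrt (m - |((p : ℤ) : ℝ)|) *
    (scaledCoeff m c p + 1 / 2 * scaledCoeff m c (p - 1) + 1 / 2 * scaledCoeff m c (p + 1)) := rfl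

lemma inner_jacobiOp (m : ℕ) (c d : EuclideanSpace ℝ (Finset.Ioo (-(m : ℤ)) m)) :
    inner ℝ (jacobiOp m c) d = ∫ x, 2 / (1 + x ^ 2) * trigPoly m (scaledCoeff m c) x *
      trigPoly m (scaledCoeff m d) x ∂cauchyProb := by
  have hi := (memHdotHalf_trigPoly m (scaledCoeff m c)).integrable
  have hw : Integrable (fun x => 2 / (1 + x ^ 2) * trigPoly m (scaledCoeff m c) x) cauchyProb :=
    memLp_one_iff_integrable.1 (memLp_weight_mul (memLp_one_iff_integrable.2 hi))
  rw [integral_mul_trigPoly m _ hw, PiLp.inner_apply, ← Finset.sum_coe_sort (Finset.Ioo (-(m : ℤ)) m)]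
  refine Finset.sum_congr rfl fun p _ => ?_
  rw [hart_weight_mul hi, hart_trigPoly m (scaledCoeff_of_le c),
    hart_trigPoly m (scaledCoeff_of_le c), hart_trigPoly m (scaledCoeff_of_le c), jacobiOp_apply,
    scaledCoeff_coe d]
  simp only [RCLike.inner_apply, conj_trivial]
  ring

lemma jacobiOp_isSymmetric (m : ℕ) : (jacobiOp m).IsSymmetric := by
  intro c d
  rw [inner_jacobiOp, real_inner_comm, inner_jacobiOp]
  congr 1
  ext x
  ring

lemma eq_zero_of_scaledCoeff_eq_zero {m : ℕ} {c : EuclideanSpace ℝ (Finset.Ioo (-(m : ℤ)) m)}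
    (h : ∀ n, scaledCoeff m c n = 0) : c = 0 := by
  ext p
  have h1 := h p
  rw [scaledCoeff_coe] at h1
  exact (mul_eq_zero.1 h1).resolve_left (Real.sqrt_pos.2 (sub_abs_pos p)).ne'

/-- The quadratic form is `∫ (1 + cos θ) B²` with an everywhere positive weight on the line. -/
lemma inner_jacobiOp_self_pos {m : ℕ} {c : EuclideanSpace ℝ (Finset.Ioo (-(m : ℤ)) m)}
    (hc : c ≠ 0) : 0 < inner ℝ (jacobiOp m c) c := by
  rw [inner_jacobiOp]
  set B := trigPoly m (scaledCoeff m c) with hB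
  have hL := (memHdotHalf_trigPoly m (scaledCoeff m c)).memLp
  have hn : ∀ x, 0 ≤ 2 / (1 + x ^ 2) * B x * B x := fun x => by
    rw [mul_assoc]
    exact mul_nonneg (by positivity) (mul_self_nonneg _)
  have hint : Integrable (fun x => 2 / (1 + x ^ 2) * B x * B x) cauchyProb :=
    (memLp_weight_mul hL).integrable_mul hL
  refine lt_of_le_of_ne (integral_nonneg hn) fun h0 => hc ?_
  have h1 := (integral_eq_zero_iff_of_nonneg hn hint).1 h0.symm
  have h2 : B =ᵐ[cauchyProb] 0 := h1.mono fun x hx => by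
    have hx' : 2 / (1 + x ^ 2) * B x * B x = 0 := hx
    have := one_add_sq_pos x
    have h3 : 2 / (1 + x ^ 2) ≠ 0 := by positivity
    simpa [h3, mul_assoc] using hx'
  refine eq_zero_of_scaledCoeff_eq_zero fun n => ?_
  rw [← hart_trigPoly m (scaledCoeff_of_le c) n, ← hB,
    hart_congr (absolutelyContinuous_cauchyProb.ae_eq h2)]
  simp [hart]

/-- The three-term recursion for the coefficients of an eigenfunction of `L₊`. -/
def IsMode (m : ℕ) (e : ℝ) (b : ℤ → ℝ) : Prop :=
  (∀ n : ℤ, (m : ℤ) ≤ |n| → b n = 0) ∧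
    ∀ n : ℤ, (|(n : ℝ)| - m) * (b n + 1 / 2 * b (n - 1) + 1 / 2 * b (n + 1)) = e * b n

/-- As `b (-m) = 0` and `|n| - m ≠ 0` inside the block, the recursion computes every coefficient
from the one at `-m + 1`. Hence eigenvalues are simple. -/
lemma IsMode.eq_zero {m : ℕ} {e : ℝ} {b : ℤ → ℝ} (hb : IsMode m e b)
    (h0 : b (-(m : ℤ) + 1) = 0) (n : ℤ) : b n = 0 := by
  have key : ∀ k : ℕ, b (-(m : ℤ) + k) = 0 ∧ b (-(m : ℤ) + k + 1) = 0 := by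
    intro k
    induction k with
    | zero =>
      refine ⟨hb.1 _ (by simp), by simpa using h0⟩
    | succ k ih =>
      push_cast
      refine ⟨by rw [← add_assoc]; exact ih.2, ?_⟩
      set p : ℤ := -(m : ℤ) + k + 1 with hp
      have e1 : -(m : ℤ) + (k + 1) + 1 = p + 1 := by omega
      rw [e1]
      by_cases h1 : |p| < m
      · have h2 := hb.2 p
        have h3 : b (p - 1) = 0 := by
          have : p - 1 = -(m : ℤ) + k := by omega
          rw [this]; exact ih.1
        rw [ih.2, h3] at h2
        have h4 : |(p : ℝ)| - m ≠ 0 := by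
          have : |(p : ℝ)| < m := by exact_mod_cast h1
          linarith
        simpa [h4] using h2
      · rw [abs_lt] at h1
        refine hb.1 _ ?_
        rw [le_abs]
        left
        omega
  by_cases h1 : |n| < m
  · obtain ⟨h2, _⟩ := abs_lt.1 h1
    have := (key (n + m).toNat).1
    rwa [Int.toNat_of_nonneg (by omega), show -(m : ℤ) + (n + m) = n by ring] at this
  · exact hb.1 n (not_lt.1 h1)

lemma isMode_scaledCoeff {m : ℕ} {μ : ℝ} {c : EuclideanSpace ℝ (Finset.Ioo (-(m : ℤ)) m)}
    (h : jacobiOp m c = μ • c) : IsMode m (-μ) (scaledCoeff m c) := by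
  refine ⟨scaledCoeff_of_le c, fun n => ?_⟩
  by_cases hn : n ∈ Finset.Ioo (-(m : ℤ)) m
  · have h1 := congrArg (fun v => v ⟨n, hn⟩) h
    simp only [jacobiOp_apply, PiLp.smul_apply, smul_eq_mul] at h1
    have h2 := scaledCoeff_coe c ⟨n, hn⟩
    have h3 := Real.mul_self_sqrt (sub_abs_pos ⟨n, hn⟩).le
    simp only at h2 h3
    set s := Real.sqrt (m - |(n : ℝ)|)
    set w := scaledCoeff m c n + 1 / 2 * scaledCoeff m c (n - 1) + 1 / 2 * scaledCoeff m c (n + 1)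
    rw [h2]
    linear_combination -s * h1 + w * h3
  · have hn' : (m : ℤ) ≤ |n| := not_lt.1 fun h2 => hn (mem_Ioo_neg_iff.2 h2)
    rw [scaledCoeff_of_le c n hn']
    -- At `|n| = m` a neighbour may lie in the block, but the factor `|n| - m` removes it; for `|n|
    -- > m` all three coefficients vanish.
    rcases hn'.eq_or_lt with h2 | h2
    · have : |(n : ℝ)| - m = 0 := by
        rw [sub_eq_zero]; exact_mod_cast h2.symm
      rw [this]; ring
    · rw [scaledCoeff_of_le c (n - 1), scaledCoeff_of_le c (n + 1)]
      · ring
      · rcases abs_cases n with h | h <;> rcases abs_cases (n + 1) with h' | h' <;> omega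
      · rcases abs_cases n with h | h <;> rcases abs_cases (n - 1) with h' | h' <;> omega

/-- The negative eigenvalues of `L₊` and the coefficients of their eigenfunctions. -/
lemma exists_modes (m : ℕ) : ∃ (e : Fin (2 * m - 1) → ℝ) (b : Fin (2 * m - 1) → ℤ → ℝ),
    StrictMono e ∧ (∀ k, e k < 0) ∧ (∀ k, IsMode m (e k) (b k)) ∧ (∀ k, ∃ n, b k n ≠ 0) ∧
    ∀ h : ℤ → ℝ, (∀ k, ∑ n ∈ Finset.Ioo (-(m : ℤ)) m, b k n * h n = 0) →
      ∀ n : ℤ, |n| < m → h n = 0 := by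
  have hfr : Module.finrank ℝ (EuclideanSpace ℝ (Finset.Ioo (-(m : ℤ)) (m : ℤ))) = 2 * m - 1 := by
    rw [finrank_euclideanSpace, Fintype.card_coe, Int.card_Ioo]
    omega
  have hT := jacobiOp_isSymmetric m
  set μ := hT.eigenvalues hfr with hμ
  set v := hT.eigenvectorBasis hfr with hv
  have happ : ∀ k, jacobiOp m (v k) = μ k • v k := fun k => hT.apply_eigenvectorBasis hfr k
  have hv0 : ∀ k, v k ≠ 0 := fun k => v.orthonormal.ne_zero k
  have hmode : ∀ k, IsMode m (-μ k) (scaledCoeff m (v k)) := fun k => isMode_scaledCoeff (happ k)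
  have hinj : Function.Injective μ := by
    intro i j hij
    by_contra hne
    set s : ℤ := -(m : ℤ) + 1
    have hi := hmode i
    have hj := hmode j
    rw [← hij] at hj
    -- The combination of the two modes whose coefficient at `s = -m + 1` cancels must vanish,
    -- contradicting orthonormality of the eigenvectors.
    have hd : IsMode m (-μ i) fun n => scaledCoeff m (v j) s * scaledCoeff m (v i) n -
        scaledCoeff m (v i) s * scaledCoeff m (v j) n := by
      refine ⟨fun n hn => by simp only [hi.1 n hn, hj.1 n hn]; ring, fun n => ?_⟩
      linear_combination scaledCoeff m (v j) s * hi.2 n - scaledCoeff m (v i) s * hj.2 n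
    have hz := hd.eq_zero (by ring)
    have hvec : scaledCoeff m (v j) s • v i + (-scaledCoeff m (v i) s) • v j = 0 := by
      refine eq_zero_of_scaledCoeff_eq_zero fun n => ?_
      rw [scaledCoeff_add, scaledCoeff_smul, scaledCoeff_smul]
      linarith [hz n]
    have hin := congrArg (fun w => inner ℝ (v j) w) hvec
    simp only [inner_add_right, inner_smul_right, inner_zero_right,
      v.inner_eq_one, v.inner_eq_zero (Ne.symm hne)] at hin
    have : scaledCoeff m (v i) s = 0 := by linarith
    exact hv0 i (eq_zero_of_scaledCoeff_eq_zero (hi.eq_zero this))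
  refine ⟨fun k => -μ k, fun k => scaledCoeff m (v k), ?_, ?_, hmode, ?_, ?_⟩
  · exact ((hT.eigenvalues_antitone hfr).strictAnti_of_injective hinj).neg
  · intro k
    have h1 := inner_jacobiOp_self_pos (hv0 k)
    rw [happ, inner_smul_left, v.inner_eq_one] at h1
    simp only [conj_trivial, mul_one] at h1
    linarith
  · intro k
    by_contra! h
    exact hv0 k (eq_zero_of_scaledCoeff_eq_zero h)
  · intro h hh n hn
    -- One square root is already in `scaledCoeff`; absorbing it into `h` turns the hypotheses into
    -- orthogonality of `w` to the whole eigenbasis.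
    set w : EuclideanSpace ℝ (Finset.Ioo (-(m : ℤ)) (m : ℤ)) :=
      WithLp.toLp 2 fun p => Real.sqrt (m - |((p : ℤ) : ℝ)|) * h p with hw
    have hort : ∀ k, inner ℝ (v k) w = 0 := by
      intro k
      rw [← hh k, PiLp.inner_apply, ← Finset.sum_coe_sort (Finset.Ioo (-(m : ℤ)) m)]
      refine Finset.sum_congr rfl fun p _ => ?_
      beta_reduce
      rw [scaledCoeff_coe]
      simp only [hw, RCLike.inner_apply, conj_trivial]
      ring
    have hw0 : w = 0 := by
      rw [← v.sum_repr' w]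
      simp [hort]
    have h1 := congrArg (fun u => u ⟨n, mem_Ioo_neg_iff.2 hn⟩) hw0
    simp only [hw, PiLp.zero_apply] at h1
    exact (mul_eq_zero.1 h1).resolve_left
      (Real.sqrt_pos.2 (sub_abs_pos ⟨n, mem_Ioo_neg_iff.2 hn⟩)).ne'

/-! ### The eigenfunctions with negative eigenvalues -/

/-- The function `(1 + cos θ) B(θ)`, `B` the Hartley polynomial with coefficients `b`. -/
def modeFun (m : ℕ) (b : ℤ → ℝ) (x : ℝ) : ℝ := 2 / (1 + x ^ 2) * trigPoly m b x

lemma modeFun_eq (m : ℕ) (b : ℤ → ℝ) : modeFun m b = fun x =>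
    ∑ n ∈ Finset.Ioo (-(m : ℤ)) m,
      b n * (cas n x + 1 / 2 * cas (n - 1) x + 1 / 2 * cas (n + 1) x) := by
  ext x
  rw [modeFun, trigPoly, Finset.mul_sum]
  refine Finset.sum_congr rfl fun n _ => ?_
  rw [← weight_mul_cas]
  ring

lemma memHdotHalf_modeFun (m : ℕ) (b : ℤ → ℝ) : MemHdotHalf (modeFun m b) := by
  rw [modeFun_eq]
  exact MemHdotHalf.sum fun n _ => (((memHdotHalf_cas n).add
    ((memHdotHalf_cas (n - 1)).const_mul _)).add
      ((memHdotHalf_cas (n + 1)).const_mul _)).const_mul _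

lemma memLp_modeFun (m : ℕ) (b : ℤ → ℝ) : MemLp (modeFun m b) 2 :=
  memLp_div_one_add_sq_mul (memHdotHalf_trigPoly m b).aestronglyMeasurable (abs_trigPoly_le m b) 2

lemma memH1_modeFun (m : ℕ) (b : ℤ → ℝ) : MemH1 (modeFun m b) := by
  refine HasL2Deriv.memH1 ?_ (memLp_modeFun m b)
  rw [modeFun_eq]
  exact HasL2Deriv.sum fun n _ => (((hasL2Deriv_cas n).add
    ((hasL2Deriv_cas (n - 1)).const_mul _)).add
      ((hasL2Deriv_cas (n + 1)).const_mul _)).const_mul _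

lemma integral_mul_modeFun (m : ℕ) (b : ℤ → ℝ) {f : ℝ → ℝ} (hf : Integrable f cauchyProb) :
    ∫ x, f x * modeFun m b x =
      2 * Real.pi * ∑ n ∈ Finset.Ioo (-(m : ℤ)) m, b n * hart f n := by
  rw [← integral_mul_trigPoly m b hf, ← integral_mul_div_one_add_sq]
  congr 1
  ext x
  rw [modeFun]
  ring

lemma integrable_modeFun_mul (m : ℕ) (b : ℤ → ℝ) {f : ℝ → ℝ} (hf : Integrable f cauchyProb) :
    Integrable fun x => modeFun m b x * f x := by
  have h1 : Integrable (fun x => f x * trigPoly m b x) cauchyProb :=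
    hf.mul_bdd (memHdotHalf_trigPoly m b).integrable.1
      (Filter.Eventually.of_forall (abs_trigPoly_le m b))
  refine (integrable_div_one_add_sq_mul h1 2).congr (Filter.Eventually.of_forall fun x => ?_)
  simp only [modeFun]
  ring

/-- Since `modeFun` carries the weight `2 / (1 + x²)`, its pairing with `f` under `dx` is `2π` times
a Parseval sum against `b`; the recursion then matches both sides frequency by frequency. No square
integrability of `f` on the line is needed. -/
lemma IsMode.LplusForm_modeFun {m : ℕ} {e : ℝ} {b : ℤ → ℝ} (hb : IsMode m e b) {f : ℝ → ℝ}
    (hf : MemHdotHalf f) : LplusForm m f (modeFun m b) = e * ∫ x, f x * modeFun m b x := by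
  have hB := memHdotHalf_trigPoly m b
  have h1 := hasSum_LplusForm m hf (memHdotHalf_modeFun m b)
  have h2 := (hasSum_hart_mul hf.memLp hB.memLp).mul_left (e * (2 * Real.pi))
  rw [mul_assoc e, ← integral_mul_div_one_add_sq] at h2
  have e1 : ∀ x, f x * modeFun m b x = 2 / (1 + x ^ 2) * (f x * trigPoly m b x) := fun x => by
    rw [modeFun]; ring
  simp only [e1]
  refine h1.unique ?_
  have e2 : ∀ n : ℤ, 2 * Real.pi * ((|(n : ℝ)| - m) * (hart f n * hart (modeFun m b) n)) =
      e * (2 * Real.pi) * (hart f n * hart (trigPoly m b) n) := fun n => by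
    have h3 : hart (modeFun m b) n = b n + 1 / 2 * b (n - 1) + 1 / 2 * b (n + 1) := by
      have := hart_weight_mul hB.integrable n
      rw [hart_trigPoly m hb.1, hart_trigPoly m hb.1, hart_trigPoly m hb.1] at this
      exact this
    rw [h3, hart_trigPoly m hb.1]
    linear_combination 2 * Real.pi * hart f n * hb.2 n
  simp only [e2]
  exact h2

lemma IsMode.isEigenfunction {m : ℕ} {e : ℝ} {b : ℤ → ℝ} (hb : IsMode m e b)
    (h0 : ∃ n, b n ≠ 0) : IsEigenfunction m e (modeFun m b) := by
  refine ⟨memH1_modeFun m b, fun hz => ?_, memHdotHalf_modeFun m b,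
    fun η hη _ => hb.LplusForm_modeFun hη⟩
  obtain ⟨n, hn⟩ := h0
  apply hn
  rw [← hart_trigPoly m hb.1]
  refine not_not.1 fun h => not_ae_zero_of_hart_ne h (hz.mono fun x hx => ?_)
  have hx' : 2 / (1 + x ^ 2) * trigPoly m b x = 0 := hx
  have := one_add_sq_pos x
  exact (mul_eq_zero.1 hx').resolve_left (by positivity)

/-! ### Uniqueness of the eigenfunctions -/

/-- On frequencies `|n| ≥ m` the form of `L₊` is nonnegative, whereas here it equals `e ∫ v²` with
`e < 0`. -/
lemma SolvesLplus.ae_zero_of_hart_eq_zero {m : ℕ} {e : ℝ} (he : e < 0) {v : ℝ → ℝ}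
    (hv : SolvesLplus m e v) (hv2 : MemLp v 2) (h0 : ∀ n : ℤ, |n| < m → hart v n = 0) :
    v =ᵐ[volume] 0 := by
  have h1 : 0 ≤ LplusForm m v v := by
    refine (hasSum_LplusForm m hv.1 hv.1).nonneg fun n => ?_
    by_cases hn : |n| < m
    · rw [h0 n hn]; simp
    · have h2 : (m : ℝ) ≤ |(n : ℝ)| := by exact_mod_cast not_lt.1 hn
      exact mul_nonneg (by have := Real.pi_pos; positivity)
        (mul_nonneg (sub_nonneg.2 h2) (mul_self_nonneg _))
  rw [hv.2 v hv.1 hv2] at h1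
  have hn : ∀ x, 0 ≤ v x * v x := fun x => mul_self_nonneg _
  have h2 : 0 ≤ ∫ x, v x * v x := integral_nonneg hn
  have h3 : ∫ x, v x * v x = 0 := by nlinarith
  rw [integral_eq_zero_iff_of_nonneg hn (hv2.integrable_mul hv2)] at h3
  exact h3.mono fun x hx => mul_self_eq_zero.1 hx

lemma IsMode.integral_mul_eq_zero {m : ℕ} {e e' : ℝ} {b : ℤ → ℝ} (hb : IsMode m e' b)
    {v : ℝ → ℝ} (hv : SolvesLplus m e v) (hne : e ≠ e') : ∫ x, v x * modeFun m b x = 0 := by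
  have h1 := hb.LplusForm_modeFun hv.1
  have h2 := hv.2 _ (memHdotHalf_modeFun m b) (memLp_modeFun m b)
  rw [LplusForm_comm, h1] at h2
  simp only [mul_comm (modeFun m b _)] at h2
  exact (mul_eq_zero.1 (show (e - e') * _ = 0 by linear_combination -h2)).resolve_left
    (sub_ne_zero.2 hne)

/-- The eigenfunctions of `L₊` with negative eigenvalue are multiples of the `modeFun`s. -/
lemma IsEigenfunction.exists_eq_of_neg {m N : ℕ} {E : Fin N → ℝ} {b : Fin N → ℤ → ℝ}
    (hE : StrictMono E) (hb : ∀ k, IsMode m (E k) (b k)) (hb0 : ∀ k, ∃ n, b k n ≠ 0)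
    (hcomp : ∀ h : ℤ → ℝ, (∀ k, ∑ n ∈ Finset.Ioo (-(m : ℤ)) m, b k n * h n = 0) →
      ∀ n : ℤ, |n| < m → h n = 0)
    {e : ℝ} (he : e < 0) {u : ℝ → ℝ} (hu : IsEigenfunction m e u) :
    ∃ (k : Fin N) (c : ℝ), c ≠ 0 ∧ e = E k ∧ u =ᵐ[volume] fun x => c * modeFun m (b k) x := by
  have key : ∀ v, SolvesLplus m e v → MemLp v 2 → (∀ k, ∫ x, v x * modeFun m (b k) x = 0) →
      v =ᵐ[volume] 0 := by
    intro v hv hv2 h0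
    refine hv.ae_zero_of_hart_eq_zero he hv2 (hcomp _ fun k => ?_)
    have h1 := h0 k
    rw [integral_mul_modeFun m _ hv.1.integrable] at h1
    exact (mul_eq_zero.1 h1).resolve_left (by have := Real.pi_ne_zero; positivity)
  by_cases hk : ∃ k, e = E k
  · obtain ⟨k, hk⟩ := hk
    have hφ := (hb k).isEigenfunction (hb0 k)
    rw [← hk] at hφ
    set φ := modeFun m (b k) with hφdef
    have hφ2 : MemLp φ 2 := memLp_modeFun m (b k)
    have hpos : ∫ x, φ x * φ x ≠ 0 := by
      intro h
      rw [integral_eq_zero_iff_of_nonneg (fun x => mul_self_nonneg _)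
        (hφ2.integrable_mul hφ2)] at h
      exact hφ.2.1 (h.mono fun x hx => mul_self_eq_zero.1 hx)
    -- Subtract the projection of `u` on `φ`. The remainder solves the same equation and is
    -- orthogonal to `φ` by the choice of `c`, and to the other modes because their eigenvalues
    -- differ; so it vanishes.
    set c := (∫ x, u x * φ x) / ∫ x, φ x * φ x with hc
    have hv := hu.2.2.add_const_mul hφ.2.2 hu.1.1 hφ2 (-c)
    have hz := key _ hv (hu.1.1.add (hφ2.const_mul (-c))) fun j => by
      by_cases hj : j = k
      · subst hj
        have i1 : Integrable fun x => u x * φ x := hu.1.1.integrable_mul hφ2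
        have i2 : Integrable fun x => φ x * φ x := hφ2.integrable_mul hφ2
        have h3 : ∫ x, (u x + -c * φ x) * φ x
            = (∫ x, u x * φ x) + -c * ∫ x, φ x * φ x := by
          rw [← integral_const_mul, ← integral_add i1 (i2.const_mul _)]
          congr 1; ext x; ring
        rw [h3, hc, neg_mul, div_mul_cancel₀ _ hpos, add_neg_cancel]
      · refine (hb j).integral_mul_eq_zero hv fun h => hj (hE.injective ?_)
        rw [← h, hk]
    have hu' : u =ᵐ[volume] fun x => c * φ x := hz.mono fun x hx => by
      have hx' : u x + -c * φ x = 0 := hx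
      linear_combination hx'
    refine ⟨k, c, fun h0 => hu.2.1 ?_, hk, hu'⟩
    refine hu'.trans (Filter.Eventually.of_forall fun x => ?_)
    simp [h0]
  · push Not at hk
    exact absurd (key u hu.2.2 hu.1.1 fun k => (hb k).integral_mul_eq_zero hu.2.2 (hk k)) hu.2.1

/-! ### Existence of the bound state family -/

lemma exists_isBoundStateFamily {m : ℕ} (hm : 1 ≤ m) :
    ∃ (E : Fin (2 * m) → ℝ) (φ : Fin (2 * m) → ℝ → ℝ) (χ : ℝ → ℝ),
      IsBoundStateFamily m E φ χ ∧
      ∀ (e : ℝ) (u : ℝ → ℝ), e ≤ 0 → IsEigenfunction m e u →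
        ∃ (k : Fin (2 * m)) (c : ℝ), e = E k ∧ u =ᵐ[volume] fun x => c * φ k x := by
  obtain ⟨e, b, hmono, hneg, hmode, hb0, hcomp⟩ := exists_modes m
  -- The only index in the `else` branch is `2m - 1`, that of the zero mode.
  refine ⟨fun k => if h : (k : ℕ) < 2 * m - 1 then e ⟨k, h⟩ else 0,
    fun k => if h : (k : ℕ) < 2 * m - 1 then modeFun m (b ⟨k, h⟩) else
      fun x => cas m x - cas (-m) x, fun x => cas m x + cas (-m) x,
    ⟨?_, ?_, ?_, ?_, isResonance_cas m⟩, ?_⟩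
  · intro i j hij
    have hij' : (i : ℕ) < j := hij
    have hi : (i : ℕ) < 2 * m - 1 := by omega
    simp only [dif_pos hi]
    split_ifs with hj
    · exact hmono hij'
    · exact hneg _
  · intro k hk
    simp only [dif_pos (show (k : ℕ) < 2 * m - 1 by omega)]
    exact hneg _
  · intro k hk
    simp only [dif_neg (show ¬ (k : ℕ) < 2 * m - 1 by omega)]
  · intro k
    by_cases hk : (k : ℕ) < 2 * m - 1
    · simp only [dif_pos hk]
      exact (hmode _).isEigenfunction (hb0 _)
    · simp only [dif_neg hk]
      exact isEigenfunction_cas hm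
  · intro e' u he hu
    rcases he.lt_or_eq with he | rfl
    · obtain ⟨k, c, -, h1, h2⟩ := hu.exists_eq_of_neg hmono hmode hb0 hcomp he
      refine ⟨⟨k, by omega⟩, c, ?_⟩
      simp only [dif_pos k.2]
      exact ⟨h1, h2⟩
    · obtain ⟨c, -, h⟩ := hu.exists_eq_of_zero hm
      refine ⟨⟨2 * m - 1, by omega⟩, c, ?_⟩
      simp only [dif_neg (lt_irrefl _)]
      exact ⟨trivial, h⟩

/-! ### The orthogonality conditions -/

lemma psi_of_lt {m : ℕ} (φ : Fin (2 * m) → ℝ → ℝ) (χ : ℝ → ℝ) {k : ℕ} (hk : k + 1 < 2 * m) :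
    psi m φ χ ⟨k, by omega⟩ = φ ⟨k, by omega⟩ := by
  ext x
  simp only [psi]
  rw [dif_pos (by omega), if_pos hk]

lemma psi_of_eq {m : ℕ} (φ : Fin (2 * m) → ℝ → ℝ) (χ : ℝ → ℝ) {k : ℕ} (hk : k + 1 = 2 * m) :
    psi m φ χ ⟨k, by omega⟩ = fun x => φ ⟨k, by omega⟩ x / (1 + x ^ 2) := by
  ext x
  simp only [psi]
  rw [dif_pos (by omega), if_neg (by omega)]

lemma psi_last {m : ℕ} (φ : Fin (2 * m) → ℝ → ℝ) (χ : ℝ → ℝ) :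
    psi m φ χ ⟨2 * m, by omega⟩ = fun x => χ x / (1 + x ^ 2) := by
  ext x
  simp only [psi]
  rw [dif_neg (by omega)]

lemma zeroMode_mul_ae_eq {m : ℤ} {a b : ℝ} {u : ℝ → ℝ}
    (hu : u =ᵐ[volume] fun x => a * cas m x + b * cas (-m) x) (f : ℝ → ℝ) :
    (fun x => 1 / (1 + x ^ 2) * (a * (f x * cas m x) + b * (f x * cas (-m) x))) =ᵐ[volume]
      fun x => u x / (1 + x ^ 2) * f x :=
  hu.mono fun x hx => by simp only [hx]; ring

lemma integrable_zeroMode_mul {m : ℤ} {a b : ℝ} {u : ℝ → ℝ}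
    (hu : u =ᵐ[volume] fun x => a * cas m x + b * cas (-m) x) {f : ℝ → ℝ}
    (hf : Integrable f cauchyProb) : Integrable fun x => u x / (1 + x ^ 2) * f x :=
  (integrable_div_one_add_sq_mul (((integrable_mul_cas hf m).const_mul a).add
    ((integrable_mul_cas hf (-m)).const_mul b)) 1).congr (zeroMode_mul_ae_eq hu f)

/-- Dividing by `1 + x²` replaces `dx` by `π` times the Cauchy measure, so the last two `psi` see
exactly the coefficients of `f` at `± m`. -/
lemma integral_zeroMode_mul {m : ℤ} {a b : ℝ} {u : ℝ → ℝ}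
    (hu : u =ᵐ[volume] fun x => a * cas m x + b * cas (-m) x) {f : ℝ → ℝ}
    (hf : Integrable f cauchyProb) : ∫ x, u x / (1 + x ^ 2) * f x =
      Real.pi * (a * hart f m + b * hart f (-m)) := by
  rw [← integral_congr_ae (zeroMode_mul_ae_eq hu f), integral_mul_div_one_add_sq,
    integral_add ((integrable_mul_cas hf m).const_mul a)
      ((integrable_mul_cas hf (-m)).const_mul b), integral_const_mul, integral_const_mul, one_mul]
  rfl

/-- For every bound state family, the products `ψ_k f` are integrable, and the orthogonality
conditions say that the frequencies `|n| ≤ m` of `f` vanish. -/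
lemma IsBoundStateFamily.integrable_and_orthPsi_iff {m : ℕ} (hm : 1 ≤ m) {E : Fin (2 * m) → ℝ}
    {φ : Fin (2 * m) → ℝ → ℝ} {χ : ℝ → ℝ} (h : IsBoundStateFamily m E φ χ) {f : ℝ → ℝ}
    (hf : MemHdotHalf f) :
    (∀ k, Integrable fun x => psi m φ χ k x * f x) ∧
      (OrthPsi m φ χ f ↔ ∀ n : ℤ, |n| ≤ m → hart f n = 0) := by
  obtain ⟨e, b, hmono, hneg, hmode, hb0, hcomp⟩ := exists_modes m
  have hfi := hf.integrable
  have h1 : ∀ k : Fin (2 * m - 1), ∃ (j : Fin (2 * m - 1)) (c : ℝ), c ≠ 0 ∧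
      E ⟨k, by omega⟩ = e j ∧ φ ⟨k, by omega⟩ =ᵐ[volume] fun x => c * modeFun m (b j) x := fun k =>
    (h.eigen ⟨k, by omega⟩).exists_eq_of_neg hmono hmode hb0 hcomp (h.neg _ (by simp only; omega))
  choose σ c hc hσ hφ using h1
  -- Distinct energies force distinct modes, so by counting every mode occurs among the given `φ`;
  -- their order need not be compared.
  have hσinj : Function.Injective σ := by
    intro i j hij
    have h2 : E ⟨i, by omega⟩ = E ⟨j, by omega⟩ := by rw [hσ, hσ, hij]
    have h3 := h.strictMono.injective h2
    simp only [Fin.mk.injEq] at h3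
    exact Fin.ext h3
  have hσsurj : Function.Surjective σ := Finite.injective_iff_surjective.1 hσinj
  have hlast := h.eigen ⟨2 * m - 1, by omega⟩
  rw [h.zero ⟨2 * m - 1, by omega⟩ (by simp only; omega)] at hlast
  obtain ⟨d, hd, hφlast⟩ := hlast.exists_eq_of_zero hm
  have hφlast' : φ ⟨2 * m - 1, by omega⟩ =ᵐ[volume] fun x => d * cas m x + (-d) * cas (-m) x :=
    hφlast.trans (Filter.Eventually.of_forall fun x => by ring)
  obtain ⟨a₁, a₂, ha, hχ⟩ := h.resonance.exists_eq hm
  have hmodeae : ∀ k : Fin (2 * m - 1), (fun x => c k * (modeFun m (b (σ k)) x * f x)) =ᵐ[volume]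
      fun x => φ ⟨k, by omega⟩ x * f x := fun k =>
    (hφ k).mono fun x hx => by simp only [hx]; ring
  have hcases : ∀ k : Fin (2 * m + 1), (∃ j : Fin (2 * m - 1), k = ⟨j, by omega⟩) ∨
      k = ⟨2 * m - 1, by omega⟩ ∨ k = ⟨2 * m, by omega⟩ := by
    intro k
    rcases lt_trichotomy (k : ℕ) (2 * m - 1) with hk | hk | hk
    · exact Or.inl ⟨⟨k, hk⟩, rfl⟩
    · exact Or.inr (Or.inl (Fin.ext hk))
    · exact Or.inr (Or.inr (Fin.ext (by simp only; omega)))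
  have I1 : ∀ j : Fin (2 * m - 1), ∫ x, psi m φ χ ⟨j, by omega⟩ x * f x =
      c j * (2 * Real.pi * ∑ n ∈ Finset.Ioo (-(m : ℤ)) m, b (σ j) n * hart f n) := by
    intro j
    rw [psi_of_lt φ χ (by omega), ← integral_congr_ae (hmodeae j), integral_const_mul,
      ← integral_mul_modeFun m _ hfi]
    simp only [mul_comm]
  have I2 : ∫ x, psi m φ χ ⟨2 * m - 1, by omega⟩ x * f x =
      Real.pi * (d * hart f m + (-d) * hart f (-m)) := by
    rw [psi_of_eq φ χ (by omega)]
    exact integral_zeroMode_mul hφlast' hfi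
  have I3 : ∫ x, psi m φ χ ⟨2 * m, by omega⟩ x * f x =
      Real.pi * (a₁ * hart f m + a₂ * hart f (-m)) := by
    rw [psi_last]
    exact integral_zeroMode_mul hχ hfi
  refine ⟨fun k => ?_, fun ho => ?_, fun hz k => ?_⟩
  · rcases hcases k with ⟨j, rfl⟩ | rfl | rfl
    · rw [psi_of_lt φ χ (by omega)]
      exact ((integrable_modeFun_mul m _ hfi).const_mul _).congr (hmodeae j)
    · rw [psi_of_eq φ χ (by omega)]
      exact integrable_zeroMode_mul hφlast' hfi
    · rw [psi_last]
      exact integrable_zeroMode_mul hχ hfi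
  · have hpi := Real.pi_ne_zero
    have hlow := hcomp (hart f) fun k => by
      obtain ⟨j, rfl⟩ := hσsurj k
      have h2 := ho ⟨j, by omega⟩
      rw [I1] at h2
      exact (mul_eq_zero.1 ((mul_eq_zero.1 h2).resolve_left (hc j))).resolve_left (by positivity)
    -- The `L²` zero mode equates the coefficients at `m` and `-m`; the resonance, having `a₁ + a₂ ≠
    -- 0`, then annihilates both.
    have h2 := (mul_eq_zero.1 (I2.symm.trans (ho _))).resolve_left hpi
    have h3 := (mul_eq_zero.1 (I3.symm.trans (ho _))).resolve_left hpi
    have h4 : hart f m = hart f (-m) := by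
      have : d * (hart f m - hart f (-m)) = 0 := by linear_combination h2
      exact sub_eq_zero.1 ((mul_eq_zero.1 this).resolve_left hd)
    have h5 : hart f (-m) = 0 := by
      have : (a₁ + a₂) * hart f (-m) = 0 := by linear_combination h3 - a₁ * h4
      exact (mul_eq_zero.1 this).resolve_left ha
    intro n hn
    rcases hn.lt_or_eq with hn | hn
    · exact hlow n hn
    · rcases (abs_eq (by positivity)).1 hn with rfl | rfl
      · rw [h4, h5]
      · exact h5
  · have hp := hz m (by simp)
    have hq := hz (-m) (by simp)
    rcases hcases k with ⟨j, rfl⟩ | rfl | rfl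
    · rw [I1, Finset.sum_eq_zero fun n hn => by rw [hz n (mem_Ioo_neg_iff.1 hn).le, mul_zero]]
      simp
    · rw [I2, hp, hq]; simp
    · rw [I3, hp, hq]; simp

/-! ### Coercivity -/

/-- Termwise comparison: `(m + 1)(|n| - m) - |n| = m (|n| - m - 1)`, which is nonnegative on the
surviving frequencies. -/
lemma LplusForm_ge_of_hart_eq_zero {m : ℕ} {f : ℝ → ℝ} (hf : MemHdotHalf f)
    (h0 : ∀ n : ℤ, |n| ≤ m → hart f n = 0) :
    1 / ((m : ℝ) + 1) * hdotNormSq f ≤ LplusForm m f f := by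
  refine hasSum_le (fun n => ?_) ((hasSum_hdotNormSq hf).mul_left (1 / ((m : ℝ) + 1)))
    (hasSum_LplusForm m hf hf)
  by_cases hn : |n| ≤ m
  · rw [h0 n hn]; simp
  · have h1 : (m : ℝ) + 1 ≤ |(n : ℝ)| := by
      have : (m : ℤ) + 1 ≤ |n| := by omega
      exact_mod_cast this
    have h2 : 1 / ((m : ℝ) + 1) * |(n : ℝ)| ≤ |(n : ℝ)| - m := by
      rw [one_div_mul_eq_div, div_le_iff₀ (by positivity)]
      nlinarith [Nat.cast_nonneg (α := ℝ) m]
    calc _ = 2 * Real.pi * ((1 / ((m : ℝ) + 1) * |(n : ℝ)|) * (hart f n * hart f n)) := by ring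
      _ ≤ _ := mul_le_mul_of_nonneg_left
        (mul_le_mul_of_nonneg_right h2 (mul_self_nonneg _)) (by have := Real.pi_pos; positivity)

lemma hdotNormSq_cas (n : ℤ) : hdotNormSq (cas n) = 2 * Real.pi * |(n : ℝ)| := by
  -- For `m = 0` the potential vanishes and the form of `L₊` is that of the half-Laplacian.
  have h := LplusForm_cas_left 0 n (memHdotHalf_cas n)
  rw [hart_cas, if_pos rfl] at h
  simpa [LplusForm, hdotNormSq] using h

end

end HalfWave

/-! ### The coercivity estimate and its optimality -/

theorem corollary1 (m : ℕ) (hm : 1 ≤ m) :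
    -- the functions `φ_k` and the resonance exist, and the `φ_k` are, up to scalar factors,
    -- all the eigenfunctions with eigenvalue at most zero
    (∃ (E : Fin (2 * m) → ℝ) (φ : Fin (2 * m) → ℝ → ℝ) (χ : ℝ → ℝ),
      HalfWave.IsBoundStateFamily m E φ χ ∧
      ∀ (e : ℝ) (u : ℝ → ℝ), e ≤ 0 → HalfWave.IsEigenfunction m e u →
        ∃ (k : Fin (2 * m)) (c : ℝ), e = E k ∧ u =ᵐ[MeasureTheory.volume] fun x => c * φ k x) ∧
    ∀ (E : Fin (2 * m) → ℝ) (φ : Fin (2 * m) → ℝ → ℝ) (χ : ℝ → ℝ),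
      HalfWave.IsBoundStateFamily m E φ χ →
      -- all integrals in the claim converge absolutely on the energy space
      (∀ f : ℝ → ℝ, HalfWave.MemHdotHalf f →
        (∀ k, MeasureTheory.Integrable (fun x : ℝ => HalfWave.psi m φ χ k x * f x)) ∧
        MeasureTheory.Integrable (fun x : ℝ => 2 * (m : ℝ) / (1 + x ^ 2) * (f x * f x)) ∧
        (∀ x : ℝ, MeasureTheory.Integrable (fun y : ℝ =>
          ‖HalfWave.Qmap m x - HalfWave.Qmap m y‖ ^ 2 / (x - y) ^ 2 * f y)) ∧
        MeasureTheory.Integrable (fun x : ℝ => f x * HalfWave.Rop m f x)) ∧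
      -- the coercivity estimate
      (∀ f g : ℝ → ℝ, HalfWave.MemHdotHalf f → HalfWave.MemHdotHalf g →
        HalfWave.OrthPsi m φ χ f → HalfWave.OrthPsi m φ χ g →
        HalfWave.LplusForm m f f + HalfWave.LminusForm m g g ≥
          1 / ((m : ℝ) + 1) * (HalfWave.hdotNormSq f + HalfWave.hdotNormSq g)) ∧
      -- the constant is optimal
      (∀ c : ℝ,
        (∀ f g : ℝ → ℝ, HalfWave.MemHdotHalf f → HalfWave.MemHdotHalf g →
          HalfWave.OrthPsi m φ χ f → HalfWave.OrthPsi m φ χ g →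
          HalfWave.LplusForm m f f + HalfWave.LminusForm m g g ≥
            c * (HalfWave.hdotNormSq f + HalfWave.hdotNormSq g)) →
        c ≤ 1 / ((m : ℝ) + 1)) := by
  refine ⟨HalfWave.exists_isBoundStateFamily hm, fun E φ χ h => ⟨fun f hf => ?_, ?_, ?_⟩⟩
  · exact ⟨(h.integrable_and_orthPsi_iff hm hf).1,
      HalfWave.integrable_div_one_add_sq_mul (hf.memLp.integrable_mul hf.memLp) _,
      HalfWave.integrable_Rop_integrand m hf.integrable,
      HalfWave.integrable_mul_Rop m hf.integrable⟩
  · intro f g hf hg hfo hgo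
    have h1 := HalfWave.LplusForm_ge_of_hart_eq_zero hf
      ((h.integrable_and_orthPsi_iff hm hf).2.1 hfo)
    have h2 := HalfWave.LplusForm_ge_of_hart_eq_zero hg
      ((h.integrable_and_orthPsi_iff hm hg).2.1 hgo)
    have h3 := HalfWave.LplusForm_le_LminusForm m hg.integrable
    rw [mul_add]
    linarith
  · intro c hc
    -- The lowest admissible frequency, with `g = 0`, gives equality: the form is `2π` and the
    -- squared norm is `2π (m + 1)`.
    have hf := HalfWave.memHdotHalf_cas (m + 1)
    have hg := HalfWave.memHdotHalf_zero
    have h1 := hc _ _ hf hg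
      ((h.integrable_and_orthPsi_iff hm hf).2.2 fun n hn => by
        rw [HalfWave.hart_cas, if_neg]
        rintro rfl
        rw [abs_le] at hn
        omega)
      ((h.integrable_and_orthPsi_iff hm hg).2.2 fun n _ => by simp [HalfWave.hart])
    have h2 : HalfWave.hdotNormSq (fun _ => 0) = 0 := by
      simp [HalfWave.hdotNormSq, HalfWave.halfLapForm]
    have h3 : |((m + 1 : ℤ) : ℝ)| = (m : ℝ) + 1 := by
      push_cast
      exact abs_of_nonneg (by positivity)
    rw [HalfWave.LminusForm_zero, h2, HalfWave.LplusForm_cas_left m _ hf, HalfWave.hart_cas,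
      if_pos rfl, HalfWave.hdotNormSq_cas, h3] at h1
    rw [le_div_iff₀ (by positivity)]
    have hpi := Real.pi_pos
    nlinarith
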